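/- **Setting.** Let $\mathcal X,\mathcal Y\subseteq\mathbb R^d$, let $\phi_X:\mathcal X\to H_X$, $\phi_Y:\mathcal Y\to H_Y$, $\phi_{XY}:\mathcal X\times\mathcal Y\to H_{XY}$ be maps into real inner product spaces (feature maps), with kernels $k_X(a,b)=\langle\phi_X(a),\phi_X(b)\rangle$, and $k_Y$, $k_{XY}$ defined likewise. Let $x_1,\dots,x_N\in\mathcal X$ and $y_1,\dots,y_N\in\mathcal Y$ be samples, $(\tilde x_1,\tilde y_1),\dots,(\tilde x_n,\tilde y_n)\in\mathcal X\times\mathcal Y$ filling points, and $\lambda_1,\lambda_2>0$. Put $Q_{ij}=k_X(\tilde x_i,\tilde x_j)+k_Y(\tilde y_i,\tilde y_j)$, $z_i=\frac1N\sum_j k_X(x_j,\tilde x_i)+\frac1N\sum_j k_Y(y_j,\tilde y_i)-\lambda_2\|\tilde x_i-\tilde y_i\|^2$, and let $\Phi_1,\dots,\Phi_n$ be the columns of an upper triangular matrix $U$ with $U^\top U=\big(k_{XY}((\tilde x_i,\tilde y_i),(\tilde x_j,\tilde y_j))\big)_{ij}$. Let $\Phi(X)=(\langle X,\Phi_i\Phi_i^\top\rangle)_{i}$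 and $\Phi^\star(\gamma)=\sum_i\gamma_i\Phi_i\Phi_i^\top$, let $\mathcal S^n_+$ be the cone of symmetric positive semidefinite $n\times n$ matrices, and let $\mathrm{proj}_{\mathcal S^n_+}$ be the metric projection in the Frobenius norm. For $w=(\gamma,X)\in\mathbb R^n\times\mathbb R^{n\times n}$ let $\|w\|=\|\gamma\|_2+\|X\|_F$ and $$R(w)=\Big(\tfrac1{2\lambda_2}Q\gamma-\tfrac1{2\lambda_2}z-\Phi(X),\; X-\mathrm{proj}_{\mathcal S^n_+}\big(X-(\Phi^\star(\gamma)+\lambda_1I)\big)\Big).$$ The Clarke generalized Jacobian $\partial R(w)$ is the convex hull of all limits of derivatives $R'(w^j)$ along sequences $w^j\to w$ of points of differentiability of $R$. **Algorithm.** Fix $0<\tau,\kappa<1$, $\alpha_2\ge\alpha_1>0$, $0<\beta_0<1$, $\beta_1>0$, $\beta_2>1$, $\underline\theta,\overline\theta,\theta_0>0$ and a step size $0<\eta<1/L$, where $L$ is a Lipschitz constant, in the Euclidean norm $(\|\gamma\|_2^2+\|X\|_F^2)^{1/2}$ and on $\mathbb R^n\times\mathcal S^n_+$, of $F(\gamma,X)=\big(\frac1{2\lambda_2}Q\gamma-\frac1{2\lambda_2}z-\Phi(X),\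 \Phi^\star(\gamma)+\lambda_1I\big)$. Start from $v_0=w_0\in\mathbb R^n\times\mathcal S^n_+$. For $k=0,1,2,\dots$: (i) do an extragradient step $v_{k+1}=\Pi\big(v_k-\eta F(\Pi(v_k-\eta F(v_k)))\big)$, where $\Pi$ is the projection onto $\mathbb R^n\times\mathcal S^n_+$; (ii) choose any $\mathcal J_k\in\partial R(w_k)$ and any $\Delta w_k$ with $\|(\mathcal J_k+\mu_k\mathcal I)[\Delta w_k]+R(w_k)\|\le\tau\min\{1,\kappa\|R(w_k)\|\|\Delta w_k\|\}$, where $\mu_k=\theta_k\|R(w_k)\|$, and put $\tilde w_{k+1}=w_k+\Delta w_k$; (iii) with $\rho_k=-\langle R(\tilde w_{k+1}),\Delta w_k\rangle$, let $\theta_{k+1}=\max\{\underline\theta,\beta_0\theta_k\}$ if $\rho_k\ge\alpha_2\|\Delta w_k\|^2$, $\theta_{k+1}=\beta_1\theta_k$ if $\alpha_1\|\Delta w_k\|^2\le\rho_k<\alpha_2\|\Delta w_k\|^2$, and $\theta_{k+1}=\min\{\overline\theta,\beta_2\theta_k\}$ otherwise; (iv) let $w_{k+1}=\tilde w_{k+1}$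 if $\|R(\tilde w_{k+1})\|\le\|R(v_{k+1})\|$, and $w_{k+1}=v_{k+1}$ otherwise. **Theorem.** Let $R(w^\star)=0$ and suppose that every element of $\partial R(w^\star)$ is invertible. Then there are $\varepsilon>0$ and $C>0$ such that every sequence $\{w_k\}_{k\ge0}$ generated by the algorithm from an initial point with $\|w_0-w^\star\|<\varepsilon$ satisfies $$\|R(w_{k+1})\|\le C\|R(w_k)\|^2\quad\text{for all }k\ge0,\qquad\text{and}\qquad \|R(w_k)\|\to0.$$ -/

import Mathlib

open Filter Topology
open scoped Matrix

noncomputable section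

namespace KernelOT

/-! ### Generalized Jacobians -/

section Clarke

variable {E F : Type*} [NormedAddCommGroup E] [NormedSpace ℝ E]
  [NormedAddCommGroup F] [NormedSpace ℝ F]

/-- The B-subdifferential of `f` at `x`: all limits of Fréchet derivatives of `f` along sequences of
points of differentiability that converge to `x`. -/
def bSubdifferential (f : E → F) (x : E) : Set (E →L[ℝ] F) :=
  {J | ∃ u : ℕ → E, (∀ k, DifferentiableAt ℝ f (u k)) ∧ Tendsto u atTop (𝓝 x) ∧
    Tendsto (fun k => fderiv ℝ f (u k)) atTop (𝓝 J)}

/-- The Clarke generalized Jacobian: the convex hull of the B-subdifferential. -/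
def clarkeJacobian (f : E → F) (x : E) : Set (E →L[ℝ] F) :=
  convexHull ℝ (bSubdifferential f x)

end Clarke

/-! ### Vector-matrix pairs -/

/-- Real `n × n` matrices with the Frobenius norm and inner product, that is, the Euclidean space
over the index pairs. -/
abbrev FrobMat (n : ℕ) := EuclideanSpace ℝ (Fin n × Fin n)

/-- Vector-matrix pairs `w = (γ, X)`. Mathlib's norm on the product is the maximum of the two norms;
it is only used for limits and Fréchet derivatives, which are the same for all equivalent norms. The
norm in the algorithm is `pairNorm`. -/
abbrev Pair (n : ℕ) := EuclideanSpace ℝ (Fin n) × FrobMat n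

variable {n : ℕ}

/-- An element of `FrobMat n` as a matrix. -/
def toMat (X : FrobMat n) : Matrix (Fin n) (Fin n) ℝ := Matrix.of fun i j => X (i, j)

/-- A matrix as an element of `FrobMat n`. -/
def ofMat (M : Matrix (Fin n) (Fin n) ℝ) : FrobMat n := WithLp.toLp 2 fun q => M q.1 q.2

/-- The norm `‖w‖ = ‖γ‖₂ + ‖X‖_F` of a vector-matrix pair. -/
def pairNorm (w : Pair n) : ℝ := ‖w.1‖ + ‖w.2‖

/-- The inner product of two vector-matrix pairs. -/
def pairInner (w w' : Pair n) : ℝ := inner ℝ w.1 w'.1 + inner ℝ w.2 w'.2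

/-- The Euclidean norm of a vector-matrix pair. -/
def pairEuclNorm (w : Pair n) : ℝ := √(pairInner w w)

/-- The inner product on `FrobMat n` is the Frobenius inner product `tr(Xᵀ Y)`. -/
theorem inner_frobMat (X Y : FrobMat n) :
    inner ℝ X Y = ((toMat X)ᵀ * toMat Y).trace := by
  simp only [PiLp.inner_apply, Fintype.sum_prod_type, Matrix.trace, Matrix.diag, Matrix.mul_apply,
    Matrix.transpose_apply, toMat, Matrix.of_apply]
  rw [Finset.sum_comm]
  simp [mul_comm]

/-- Every matrix has exactly one nearest point, in the Frobenius norm, in the cone of symmetric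
positive semidefinite matrices. -/
theorem existsUnique_nearest_psd (Z : FrobMat n) :
    ∃! P : FrobMat n, (toMat P).PosSemidef ∧
      ∀ S : FrobMat n, (toMat S).PosSemidef → ‖Z - P‖ ≤ ‖Z - S‖ := by
  have hcont : Continuous (toMat : FrobMat n → Matrix (Fin n) (Fin n) ℝ) := by
    refine continuous_matrix fun i j => ?_
    simp only [toMat, Matrix.of_apply]
    fun_prop
  have hcl : IsClosed {P : FrobMat n | (toMat P).PosSemidef} := by
    have : {P : FrobMat n | (toMat P).PosSemidef} = {P | (toMat P)ᴴ = toMat P} ∩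
        ⋂ x : Fin n → ℝ, {P | 0 ≤ star x ⬝ᵥ (toMat P *ᵥ x)} := by
      ext P
      simp [Matrix.posSemidef_iff_dotProduct_mulVec, Matrix.IsHermitian]
    rw [this]
    refine IsClosed.inter (isClosed_eq (by fun_prop) (by fun_prop)) (isClosed_iInter fun x => ?_)
    exact isClosed_le continuous_const (by fun_prop)
  have hzero : (toMat (0 : FrobMat n)).PosSemidef := by
    have h : toMat (0 : FrobMat n) = 0 := by ext i j; simp [toMat]
    rw [h]
    exact Matrix.PosSemidef.zero
  obtain ⟨P, hP, hd⟩ := hcl.exists_infDist_eq_dist ⟨0, hzero⟩ Z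
  have hmin : ∀ S : FrobMat n, (toMat S).PosSemidef → ‖Z - P‖ ≤ ‖Z - S‖ := fun S hS => by
    rw [← dist_eq_norm, ← dist_eq_norm, ← hd]
    exact Metric.infDist_le_dist_of_mem hS
  refine ⟨P, ⟨hP, hmin⟩, ?_⟩
  rintro P' ⟨hP', hmin'⟩
  have hM : (toMat ((1 / 2 : ℝ) • (P + P'))).PosSemidef := by
    have h : toMat ((1 / 2 : ℝ) • (P + P')) = (1 / 2 : ℝ) • (toMat P + toMat P') := by
      ext i j
      simp [toMat, mul_add]
    rw [h]
    exact (hP.add hP').smul (by norm_num)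
  have h1 := hmin _ hM
  have h2 := hmin' _ hM
  have h3 := parallelogram_law_with_norm ℝ (Z - P) (Z - P')
  have h4 : Z - P + (Z - P') = (2 : ℝ) • (Z - (1 / 2 : ℝ) • (P + P')) := by
    module
  have h5 : Z - P - (Z - P') = P' - P := by abel
  rw [h4, h5, norm_smul, Real.norm_ofNat] at h3
  have h6 : ‖P' - P‖ = 0 := by
    nlinarith [norm_nonneg (P' - P), norm_nonneg (Z - P), norm_nonneg (Z - P')]
  exact sub_eq_zero.mp (norm_eq_zero.mp h6)

/-- The metric projection onto the cone of symmetric positive semidefinite matrices, with respect to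
the Frobenius norm. -/
def projPSD (Z : FrobMat n) : FrobMat n := (existsUnique_nearest_psd Z).choose

/-- The set of pairs `(γ, X)` with `X` symmetric positive semidefinite. -/
def domain (n : ℕ) : Set (Pair n) := {w | (toMat w.2).PosSemidef}

/-- The projection onto the pairs `(γ, X)` with `X` symmetric positive semidefinite. -/
def projDomain (w : Pair n) : Pair n := (w.1, projPSD w.2)

/-! ### The kernel-based optimal transport problem -/

/-- The data of a kernel-based optimal transport problem on the domains `𝒳, 𝒴 ⊆ ℝ^d`: feature maps
into inner product spaces, `N` samples of each measure, `n` filling points, two regularization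
parameters, and an upper triangular Cholesky factor of the kernel matrix of the filling points. -/
structure Data (d n N : ℕ) (𝒳 𝒴 : Set (EuclideanSpace ℝ (Fin d))) (HX HY HXY : Type*)
    [NormedAddCommGroup HX] [InnerProductSpace ℝ HX]
    [NormedAddCommGroup HY] [InnerProductSpace ℝ HY]
    [NormedAddCommGroup HXY] [InnerProductSpace ℝ HXY] where
  φX : 𝒳 → HX
  φY : 𝒴 → HY
  φXY : 𝒳 × 𝒴 → HXY
  /-- the samples -/
  x : Fin N → 𝒳
  y : Fin N → 𝒴
  /-- the filling points -/
  xt : Fin n → 𝒳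
  yt : Fin n → 𝒴
  lam₁ : ℝ
  lam₂ : ℝ
  lam₁_pos : 0 < lam₁
  lam₂_pos : 0 < lam₂
  /-- the Cholesky factor; its `i`-th column is the vector `Φ_i` -/
  U : Matrix (Fin n) (Fin n) ℝ
  U_upper : ∀ i j, j < i → U i j = 0
  U_chol : Uᵀ * U =
    Matrix.of fun i j => (inner ℝ (φXY (xt i, yt i)) (φXY (xt j, yt j)) : ℝ)

namespace Data

variable {d n N : ℕ} {𝒳 𝒴 : Set (EuclideanSpace ℝ (Fin d))} {HX HY HXY : Type*}
  [NormedAddCommGroup HX] [InnerProductSpace ℝ HX]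
  [NormedAddCommGroup HY] [InnerProductSpace ℝ HY]
  [NormedAddCommGroup HXY] [InnerProductSpace ℝ HXY]
  (D : Data d n N 𝒳 𝒴 HX HY HXY)

/-- The kernel `k_X`. -/
def kX (a b : 𝒳) : ℝ := inner ℝ (D.φX a) (D.φX b)

/-- The kernel `k_Y`. -/
def kY (a b : 𝒴) : ℝ := inner ℝ (D.φY a) (D.φY b)

/-- `Q_ij = k_X(x̃_i, x̃_j) + k_Y(ỹ_i, ỹ_j)`. -/
def Q : Matrix (Fin n) (Fin n) ℝ := Matrix.of fun i j => D.kX (D.xt i) (D.xt j) + D.kY (D.yt i) (D.yt j)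

/-- `z_i = (1/N) ∑_j k_X(x_j, x̃_i) + (1/N) ∑_j k_Y(y_j, ỹ_i) - λ₂ ‖x̃_i - ỹ_i‖²`. -/
def z : EuclideanSpace ℝ (Fin n) := WithLp.toLp 2 fun i =>
  (1 / (N : ℝ)) * ∑ j, D.kX (D.x j) (D.xt i) + (1 / (N : ℝ)) * ∑ j, D.kY (D.y j) (D.yt i)
    - D.lam₂ * ‖(D.xt i : EuclideanSpace ℝ (Fin d)) - (D.yt i : EuclideanSpace ℝ (Fin d))‖ ^ 2

/-- The rank-one matrix `Φ_i Φ_iᵀ`. -/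
def rankOne (i : Fin n) : FrobMat n := ofMat (Matrix.vecMulVec (D.U.col i) (D.U.col i))

/-- The operator `Φ(X) = (⟨X, Φ_i Φ_iᵀ⟩)_i`. -/
def Phi (X : FrobMat n) : EuclideanSpace ℝ (Fin n) :=
  WithLp.toLp 2 fun i => inner ℝ X (D.rankOne i)

/-- The adjoint operator `Φ⋆(γ) = ∑_i γ_i Φ_i Φ_iᵀ`. -/
def PhiStar (γ : EuclideanSpace ℝ (Fin n)) : FrobMat n := ∑ i, γ i • D.rankOne i

/-- `Φ⋆(γ) + λ₁ I`. -/
def slack (γ : EuclideanSpace ℝ (Fin n)) : FrobMat n := D.PhiStar γ + D.lam₁ • ofMat 1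

/-- `(1/(2λ₂)) Q γ - (1/(2λ₂)) z - Φ(X)`. -/
def gradGamma (w : Pair n) : EuclideanSpace ℝ (Fin n) :=
  (1 / (2 * D.lam₂)) • (WithLp.toLp 2 (D.Q *ᵥ w.1.ofLp) : EuclideanSpace ℝ (Fin n))
    - (1 / (2 * D.lam₂)) • D.z - D.Phi w.2

/-- The residual map `R`. -/
def R (w : Pair n) : Pair n :=
  (D.gradGamma w, w.2 - projPSD (w.2 - D.slack w.1))

/-- The monotone operator `(∇_γ f, -∇_X f)` of the min-max problem
`min_γ max_{X ⪰ 0} f(γ, X)` with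
`f(γ, X) = (1/(4λ₂)) γᵀQγ - (1/(2λ₂)) γᵀz + q²/(4λ₂) - ⟨X, Φ⋆(γ) + λ₁ I⟩`. -/
def saddleOp (w : Pair n) : Pair n := (D.gradGamma w, D.slack w.1)

/-- One step of the extragradient method with step size `η` for the min-max problem. -/
def egStep (η : ℝ) (v : Pair n) : Pair n :=
  projDomain (v - η • D.saddleOp (projDomain (v - η • D.saddleOp v)))

/-- The step sizes of the extragradient method: `0 < η < 1 / L`, where `L` is a Lipschitz constant
of the operator on the feasible set with respect to the Euclidean norm. -/
def IsEGStepSize (η : ℝ) : Prop :=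
  0 < η ∧ ∃ L : ℝ, 0 < L ∧ η < 1 / L ∧ ∀ w ∈ domain n, ∀ w' ∈ domain n,
    pairEuclNorm (D.saddleOp w - D.saddleOp w') ≤ L * pairEuclNorm (w - w')

end Data

/-! ### The algorithm -/

/-- The numerical parameters of the semismooth Newton method. -/
structure Params where
  τ : ℝ
  κ : ℝ
  α₁ : ℝ
  α₂ : ℝ
  β₀ : ℝ
  β₁ : ℝ
  β₂ : ℝ
  θlo : ℝ
  θhi : ℝ
  /-- the initial value of the regularization parameter -/
  θinit : ℝ
  τ_pos : 0 < τ
  τ_lt : τ < 1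
  κ_pos : 0 < κ
  κ_lt : κ < 1
  α₁_pos : 0 < α₁
  α₁_le : α₁ ≤ α₂
  β₀_pos : 0 < β₀
  β₀_lt : β₀ < 1
  β₁_pos : 0 < β₁
  β₂_gt : 1 < β₂
  θlo_pos : 0 < θlo
  θhi_pos : 0 < θhi
  θinit_pos : 0 < θinit

/-- The update of the regularization parameter, where `s = ‖Δw‖²`. -/
def Params.nextTheta (p : Params) (θ ρ s : ℝ) : ℝ :=
  open Classical in
  if p.α₂ * s ≤ ρ then max p.θlo (p.β₀ * θ)
  else if p.α₁ * s ≤ ρ then p.β₁ * θ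
  else min p.θhi (p.β₂ * θ)

section Algorithm

variable {d n N : ℕ} {𝒳 𝒴 : Set (EuclideanSpace ℝ (Fin d))} {HX HY HXY : Type*}
  [NormedAddCommGroup HX] [InnerProductSpace ℝ HX]
  [NormedAddCommGroup HY] [InnerProductSpace ℝ HY]
  [NormedAddCommGroup HXY] [InnerProductSpace ℝ HXY]

/-- A run of the safeguarded inexact regularized semismooth Newton method: iterates `w`, extragradient
iterates `v`, Newton directions `Δ`, generalized Jacobians `J` and parameters `θ`. -/
structure IsRun (D : Data d n N 𝒳 𝒴 HX HY HXY) (p : Params) (η : ℝ)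
    (w v Δ : ℕ → Pair n) (J : ℕ → Pair n →L[ℝ] Pair n) (θ : ℕ → ℝ) : Prop where
  init_mem : w 0 ∈ domain n
  init_v : v 0 = w 0
  init_θ : θ 0 = p.θinit
  step_v : ∀ k, v (k + 1) = D.egStep η (v k)
  jac_mem : ∀ k, J k ∈ clarkeJacobian D.R (w k)
  /-- the inexact solution of `(J_k + μ_k I) Δw_k = -R(w_k)` with `μ_k = θ_k ‖R(w_k)‖` -/
  newton : ∀ k, pairNorm (J k (Δ k) + (θ k * pairNorm (D.R (w k))) • Δ k + D.R (w k))
    ≤ p.τ * min 1 (p.κ * pairNorm (D.R (w k)) * pairNorm (Δ k))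
  step_θ : ∀ k, θ (k + 1) =
    p.nextTheta (θ k) (-pairInner (D.R (w k + Δ k)) (Δ k)) (pairNorm (Δ k) ^ 2)
  accept : ∀ k, pairNorm (D.R (w k + Δ k)) ≤ pairNorm (D.R (v (k + 1))) →
    w (k + 1) = w k + Δ k
  safeguard : ∀ k, pairNorm (D.R (v (k + 1))) < pairNorm (D.R (w k + Δ k)) →
    w (k + 1) = v (k + 1)

/-- `w` is a sequence of iterates generated by the algorithm. -/
def GeneratedBy (D : Data d n N 𝒳 𝒴 HX HY HXY) (p : Params) (η : ℝ) (w : ℕ → Pair n) : Prop :=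
  ∃ (v Δ : ℕ → Pair n) (J : ℕ → Pair n →L[ℝ] Pair n) (θ : ℕ → ℝ), IsRun D p η w v Δ J θ

end Algorithm

end KernelOT

end

/-!
The only nonsmooth part of `R` is the projection `P` onto the positive semidefinite cone. At a
point `A` of differentiability the eigenvalues `c i` of `A` are nonzero, and differentiating
`P A * (P A - A) = 0` bounds the entries of `P'(A) A₀ - P A₀` in an eigenbasis of `A` by
`2 ‖A - A₀‖² / (|c i| + |c j|)`. When both eigenvalues are small, their eigenvectors are instead
nearly orthogonal to the range of `A₀`, and `P'(A)` contracts entrywise, so these entries are again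
quadratically small. Since `P'(A) A = P A`, this is strong semismoothness of `P`, hence of `R`.

The Clarke Jacobian is compact and upper semicontinuous, so its invertibility at the root gives a
uniform lower bound for all Jacobians nearby, and an inexact Newton step contracts quadratically as
long as `θ` stays bounded. It does: near the root the residual after a Newton step is of smaller
order than `Δw`, hence `ρ` is of smaller order than `‖Δw‖²`, which rules out the middle case of the
update, the only one that can push `θ` past a fixed bound. The extragradient iterates never move
away from the root, and the safeguard replaces a Newton point only by one with a smaller residual.
-/

noncomputable section

namespace KernelOT

/-! ### Clarke generalized Jacobians and strong semismoothness -/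

theorem isCompact_convexHull {E : Type*} [NormedAddCommGroup E] [NormedSpace ℝ E]
    [FiniteDimensional ℝ E] {s : Set E} (hs : IsCompact s) : IsCompact (convexHull ℝ s) := by
  let combinations (k : ℕ) : Set E := (fun q : (Fin k → ℝ) × (Fin k → E) => ∑ i, q.1 i • q.2 i) ''
    (stdSimplex ℝ (Fin k) ×ˢ Set.univ.pi fun _ => s)
  have hcompact (k : ℕ) : IsCompact (combinations k) :=
    ((isCompact_stdSimplex ℝ (Fin k)).prod (isCompact_univ_pi fun _ => hs)).image (by fun_prop)
  have hunion : convexHull ℝ s =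
      ⋃ k ∈ Finset.range (Module.finrank ℝ E + 2), combinations k := by
    refine Set.Subset.antisymm (fun x hx => ?_) (Set.iUnion₂_subset fun k _ => ?_)
    · obtain ⟨ι, _, z, a, hz, hind, ha, ha1, rfl⟩ := eq_pos_convex_span_of_mem_convexHull hx
      have hcard : Fintype.card ι ≤ Module.finrank ℝ E + 1 :=
        hind.card_le_finrank_succ.trans (Nat.succ_le_succ (Submodule.finrank_le _))
      let e := (Fintype.equivFin ι).symm
      exact Set.mem_iUnion₂.mpr ⟨Fintype.card ι, Finset.mem_range.mpr (Nat.lt_succ_of_le hcard),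
        (a ∘ e, z ∘ e),
        ⟨⟨fun i => (ha _).le, (e.sum_comp a).trans ha1⟩, fun i _ => hz ⟨e i, rfl⟩⟩,
        e.sum_comp fun i => a i • z i⟩
    · rintro _ ⟨⟨a, z⟩, ⟨ha, hz⟩, rfl⟩
      exact (convex_convexHull ℝ s).sum_mem (fun i _ => ha.1 i) ha.2
        fun i _ => subset_convexHull ℝ s (hz i trivial)
  rw [hunion]
  exact (Finset.range _).isCompact_biUnion fun k _ => hcompact k

theorem exists_pos_forall_mul_norm_le {E F : Type*} [NormedAddCommGroup E] [NormedSpace ℝ E]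
    [FiniteDimensional ℝ E] [NormedAddCommGroup F] [NormedSpace ℝ F] {𝒥 : Set (E →L[ℝ] F)}
    (h𝒥 : IsCompact 𝒥) (hinj : ∀ J ∈ 𝒥, Function.Injective J) :
    ∃ m > 0, ∀ J ∈ 𝒥, ∀ h, m * ‖h‖ ≤ ‖J h‖ := by
  have : ProperSpace E := FiniteDimensional.proper ℝ E
  obtain ⟨m, hm, hsphere⟩ : ∃ m > 0, ∀ q ∈ 𝒥 ×ˢ Metric.sphere (0 : E) 1, m ≤ ‖q.1 q.2‖ := by
    refine (h𝒥.prod (isCompact_sphere 0 1)).exists_forall_le' (by fun_prop) ?_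
    rintro ⟨J, h⟩ ⟨hJ, hh⟩
    rw [norm_pos_iff, map_ne_zero_iff J (hinj J hJ)]
    exact ne_zero_of_mem_unit_sphere ⟨h, hh⟩
  refine ⟨m, hm, fun J hJ h => ?_⟩
  rcases eq_or_ne h 0 with rfl | h0
  · simp
  have hunit := hsphere (J, ‖h‖⁻¹ • h) ⟨hJ, by simp [norm_smul, h0]⟩
  rwa [map_smul, norm_smul, norm_inv, norm_norm, inv_mul_eq_div,
    le_div_iff₀ (norm_pos_iff.mpr h0)] at hunit

section Clarke

variable {E F : Type*} [NormedAddCommGroup E] [NormedSpace ℝ E]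
  [NormedAddCommGroup F] [NormedSpace ℝ F] {f : E → F} {x : E}

theorem mem_bSubdifferential_iff {J : E →L[ℝ] F} :
    J ∈ bSubdifferential f x ↔
      (x, J) ∈ closure {q : E × (E →L[ℝ] F) | DifferentiableAt ℝ f q.1 ∧ fderiv ℝ f q.1 = q.2} := by
  rw [mem_closure_iff_seq_limit]
  constructor
  · rintro ⟨u, hd, hu, hJ⟩
    exact ⟨fun k => (u k, fderiv ℝ f (u k)), fun k => ⟨hd k, rfl⟩, hu.prodMk_nhds hJ⟩
  · rintro ⟨q, hq, hlim⟩
    refine ⟨fun k => (q k).1, fun k => (hq k).1, hlim.fst_nhds, ?_⟩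
    simpa only [fun k => (hq k).2] using hlim.snd_nhds

theorem isOpen_notMem_bSubdifferential (f : E → F) :
    IsOpen {q : E × (E →L[ℝ] F) | q.2 ∉ bSubdifferential f q.1} := by
  simp only [mem_bSubdifferential_iff]
  exact isClosed_closure.isOpen_compl

theorem isClosed_bSubdifferential (f : E → F) (x : E) : IsClosed (bSubdifferential f x) :=
  isOpen_compl_iff.mp ((isOpen_notMem_bSubdifferential f).preimage (Continuous.prodMk_right x))

theorem bSubdifferential_subset_closedBall {K : NNReal} (hf : LipschitzWith K f) (x : E) :
    bSubdifferential f x ⊆ Metric.closedBall 0 K := by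
  rintro J ⟨u, -, -, hJ⟩
  exact Metric.isClosed_closedBall.mem_of_tendsto hJ
    (Eventually.of_forall fun k => by simpa using norm_fderiv_le_of_lipschitz ℝ hf)

section FiniteDimensional

variable [FiniteDimensional ℝ E] [FiniteDimensional ℝ F] {K : NNReal}

theorem isCompact_clarkeJacobian (hf : LipschitzWith K f) (x : E) :
    IsCompact (clarkeJacobian f x) := by
  have : ProperSpace (E →L[ℝ] F) := FiniteDimensional.proper ℝ _
  exact isCompact_convexHull ((isCompact_closedBall 0 (K : ℝ)).of_isClosed_subset
    (isClosed_bSubdifferential f x) (bSubdifferential_subset_closedBall hf x))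

theorem eventually_bSubdifferential_subset_thickening (hf : LipschitzWith K f) (x : E) {r : ℝ}
    (hr : 0 < r) :
    ∀ᶠ w in 𝓝 x, bSubdifferential f w ⊆ Metric.thickening r (bSubdifferential f x) := by
  have : ProperSpace (E →L[ℝ] F) := FiniteDimensional.proper ℝ _
  have hfar : IsCompact (Metric.closedBall 0 K \ Metric.thickening r (bSubdifferential f x)) :=
    (isCompact_closedBall _ _).diff Metric.isOpen_thickening
  have havoid : ∀ᶠ w in 𝓝 x,
      ∀ J ∈ Metric.closedBall 0 K \ Metric.thickening r (bSubdifferential f x),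
        J ∉ bSubdifferential f w :=
    hfar.eventually_forall_of_forall_eventually fun J hJ =>
      (isOpen_notMem_bSubdifferential f).mem_nhds
        fun hmem => hJ.2 (Metric.self_subset_thickening hr _ hmem)
  filter_upwards [havoid] with w hw J hJ
  by_contra hnot
  exact hw J ⟨bSubdifferential_subset_closedBall hf w hJ, hnot⟩ hJ

theorem eventually_clarkeJacobian_subset_thickening (hf : LipschitzWith K f) (x : E) {r : ℝ}
    (hr : 0 < r) :
    ∀ᶠ w in 𝓝 x, clarkeJacobian f w ⊆ Metric.thickening r (clarkeJacobian f x) := by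
  filter_upwards [eventually_bSubdifferential_subset_thickening hf x hr] with w hw
  exact convexHull_min (hw.trans (Metric.thickening_subset_of_subset r (subset_convexHull ℝ _)))
    ((convex_convexHull ℝ _).thickening r)

theorem eventually_forall_clarkeJacobian_mul_norm_le (hf : LipschitzWith K f)
    (hinj : ∀ J ∈ clarkeJacobian f x, Function.Injective J) :
    ∃ m > 0, ∀ᶠ w in 𝓝 x, ∀ J ∈ clarkeJacobian f w, ∀ h, m * ‖h‖ ≤ ‖J h‖ := by
  obtain ⟨m, hm, hlow⟩ := exists_pos_forall_mul_norm_le (isCompact_clarkeJacobian hf x) hinj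
  refine ⟨m / 2, half_pos hm, ?_⟩
  filter_upwards [eventually_clarkeJacobian_subset_thickening hf x (half_pos hm)] with w hw J hJ h
  obtain ⟨J₀, hJ₀, hdist⟩ := Metric.mem_thickening_iff.mp (hw hJ)
  rw [dist_comm, dist_eq_norm] at hdist
  have hclose : ‖J₀ h - J h‖ ≤ m / 2 * ‖h‖ := (J₀ - J).le_of_opNorm_le hdist.le h
  linarith [hlow J₀ hJ₀ h, norm_sub_norm_le (J₀ h) (J h)]

end FiniteDimensional

/-- Strong semismoothness of `f` at `x`: the expansion along the derivative at the nearby point, not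
at `x`, has a quadratic error. It is required only at points of differentiability, and is inherited
by the Clarke Jacobians at all nearby points. -/
def IsStronglySemismoothAt (f : E → F) (x : E) : Prop :=
  ∃ C, ∀ᶠ u in 𝓝 x, DifferentiableAt ℝ f u → ‖f u - f x - fderiv ℝ f u (u - x)‖ ≤ C * ‖u - x‖ ^ 2

namespace IsStronglySemismoothAt

theorem eventually_forall_clarkeJacobian (h : IsStronglySemismoothAt f x) (hf : Continuous f) :
    ∃ C, ∀ᶠ w in 𝓝 x, ∀ J ∈ clarkeJacobian f w,
      ‖f w - f x - J (w - x)‖ ≤ C * ‖w - x‖ ^ 2 := by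
  obtain ⟨C, hC⟩ := h
  refine ⟨C, hC.eventually_nhds.mono fun w hw J hJ => ?_⟩
  have hconv : Convex ℝ ((fun J : E →L[ℝ] F => J (w - x)) ⁻¹'
      Metric.closedBall (f w - f x) (C * ‖w - x‖ ^ 2)) :=
    (convex_closedBall _ _).is_linear_preimage ⟨fun _ _ => rfl, fun _ _ => rfl⟩
  rw [norm_sub_rev, ← dist_eq_norm]
  refine convexHull_min ?_ hconv hJ
  rintro J ⟨u, hd, hu, hJ⟩
  have happly : Tendsto (fun k => fderiv ℝ f (u k) (u k - x)) atTop (𝓝 (J (w - x))) :=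
    (isBoundedBilinearMap_apply.continuous.tendsto (J, w - x)).comp
      (hJ.prodMk_nhds (hu.sub_const x))
  have hfu : Tendsto (fun k => f (u k)) atTop (𝓝 (f w)) := (hf.tendsto w).comp hu
  change dist _ _ ≤ _
  rw [dist_comm, dist_eq_norm]
  exact le_of_tendsto_of_tendsto ((hfu.sub_const (f x)).sub happly).norm
    (((hu.sub_const x).norm.pow 2).const_mul C) ((hu.eventually hw).mono fun k hk => hk (hd k))

theorem affine_sub (h : IsStronglySemismoothAt f x) (B : E →L[ℝ] F) :
    IsStronglySemismoothAt (fun u => B u - f u) x := by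
  obtain ⟨C, hC⟩ := h
  refine ⟨C, hC.mono fun u hu hd => ?_⟩
  have hf : DifferentiableAt ℝ f u := by
    simpa using B.differentiableAt.sub hd
  rw [fderiv_fun_sub B.differentiableAt hf, B.fderiv]
  calc _ = ‖-(f u - f x - fderiv ℝ f u (u - x))‖ := by
        congr 1; simp only [map_sub, sub_apply]; abel
    _ ≤ _ := by rw [norm_neg]; exact hu hf

theorem affine_prodMk {G : Type*} [NormedAddCommGroup G] [NormedSpace ℝ G]
    (h : IsStronglySemismoothAt f x) (A : E →L[ℝ] G) (a : G) :
    IsStronglySemismoothAt (fun u => (A u + a, f u)) x := by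
  obtain ⟨C, hC⟩ := h
  refine ⟨C, hC.mono fun u hu hd => ?_⟩
  have hf : DifferentiableAt ℝ f u := hd.snd
  rw [((A.hasFDerivAt.add_const a).prodMk hf.hasFDerivAt).fderiv]
  simpa [Prod.norm_def] using hu hf

theorem comp_affine {G : Type*} [NormedAddCommGroup G] [NormedSpace ℝ G] {T : G →L[ℝ] E}
    {S : E →L[ℝ] G} (hTS : ∀ e, T (S e) = e) {b : E} {w : G}
    (h : IsStronglySemismoothAt f (T w + b)) :
    IsStronglySemismoothAt (fun u => f (T u + b)) w := by
  obtain ⟨C, hC⟩ := h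
  have hcont : Tendsto (fun u => T u + b) (𝓝 w) (𝓝 (T w + b)) :=
    (T.continuous.add continuous_const).tendsto w
  refine ⟨|C| * ‖T‖ ^ 2, (hcont.eventually hC).mono fun u hu hd => ?_⟩
  have hf : DifferentiableAt ℝ f (T u + b) := by
    have hcomp : f = (fun v => f (T v + b)) ∘ fun e => u + S (e - (T u + b)) := by
      ext e; simp [hTS, add_right_comm]
    rw [hcomp]
    refine DifferentiableAt.comp _ ?_ (by fun_prop)
    simpa using hd
  have hderiv := (hf.hasFDerivAt.comp u (T.hasFDerivAt.add_const b)).fderiv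
  rw [Function.comp_def] at hderiv
  have hsub : T u + b - (T w + b) = T (u - w) := by rw [map_sub]; abel
  rw [hderiv, ContinuousLinearMap.comp_apply, ← hsub]
  calc _ ≤ |C| * ‖T u + b - (T w + b)‖ ^ 2 :=
        (hu hf).trans (mul_le_mul_of_nonneg_right (le_abs_self C) (sq_nonneg _))
    _ ≤ |C| * (‖T‖ * ‖u - w‖) ^ 2 := by
        rw [hsub]; gcongr; exact T.le_opNorm _
    _ = _ := by ring

theorem of_comp_projection {π : E →L[ℝ] E} (hπ : ∀ u, π (π u) = π u) (hfπ : ∀ u, f (π u) = f u)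
    (hx : π x = x) {C : ℝ}
    (hC : ∀ᶠ u in 𝓝 x, π u = u → DifferentiableAt ℝ f u →
      ‖f u - f x - fderiv ℝ f u (u - x)‖ ≤ C * ‖u - x‖ ^ 2) :
    IsStronglySemismoothAt f x := by
  have hcont : Tendsto π (𝓝 x) (𝓝 x) := by simpa only [hx] using π.continuous.tendsto x
  refine ⟨|C| * ‖π‖ ^ 2, (hcont.eventually hC).mono fun u hu hd => ?_⟩
  have hd' : DifferentiableAt ℝ f (π u) := by
    have hshift : f = fun e => f (e + (u - π u)) := by
      ext e; rw [← hfπ (e + _)]; simp [hπ, hfπ]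
    rw [hshift]
    refine DifferentiableAt.comp (g := f) _ ?_ (by fun_prop)
    simpa using hd
  have hderiv : fderiv ℝ f u = fderiv ℝ f (π u) ∘L π := by
    refine HasFDerivAt.fderiv ?_
    simpa [Function.comp_def, hfπ] using hd'.hasFDerivAt.comp u π.hasFDerivAt
  have hsub : π u - x = π (u - x) := by rw [map_sub, hx]
  rw [hderiv, ContinuousLinearMap.comp_apply, ← hsub, ← hfπ u]
  calc _ ≤ |C| * ‖π u - x‖ ^ 2 :=
        (hu (hπ u) hd').trans (mul_le_mul_of_nonneg_right (le_abs_self C) (sq_nonneg _))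
    _ ≤ |C| * (‖π‖ * ‖u - x‖) ^ 2 := by
        rw [hsub]; gcongr; exact π.le_opNorm _
    _ = _ := by ring

end IsStronglySemismoothAt

end Clarke

/-! ### Inexact semismooth Newton steps -/

theorem eventually_mul_norm_sub_lt {E : Type*} [SeminormedAddCommGroup E] (x : E) (b : ℝ) {c : ℝ}
    (hc : 0 < c) : ∀ᶠ w in 𝓝 x, b * ‖w - x‖ < c := by
  have hcont : Continuous fun w => b * ‖w - x‖ := by fun_prop
  exact hcont.continuousAt.eventually_lt_const (by simpa using hc)

theorem tendsto_zero_of_succ_le_mul_sq {a : ℕ → ℝ} {C : ℝ} (ha : ∀ k, 0 ≤ a k)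
    (hC : ∀ k, C * a k ≤ 1 / 2) (hsucc : ∀ k, a (k + 1) ≤ C * a k ^ 2) :
    Tendsto a atTop (𝓝 0) := by
  have hhalf (k : ℕ) : a (k + 1) ≤ 1 / 2 * a k :=
    calc a (k + 1) ≤ C * a k * a k := (hsucc k).trans_eq (by ring)
      _ ≤ 1 / 2 * a k := mul_le_mul_of_nonneg_right (hC k) (ha k)
  refine squeeze_zero ha (fun k => le_geom (by norm_num) k fun j _ => hhalf j) ?_
  simpa using (tendsto_pow_atTop_nhds_zero_of_lt_one (r := (1 / 2 : ℝ)) (by norm_num)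
    (by norm_num)).mul_const (a 0)

section Newton

variable {E F : Type*} [NormedAddCommGroup E] [NormedSpace ℝ E] [FiniteDimensional ℝ E]
  [NormedAddCommGroup F] [NormedSpace ℝ F] [FiniteDimensional ℝ F] {f : E → F} {x : E}
  {K : NNReal} (hf : LipschitzWith K f) (hsemi : IsStronglySemismoothAt f x) (hx : f x = 0)
  (hinj : ∀ J ∈ clarkeJacobian f x, Function.Injective J)

include hf hsemi hx hinj

theorem exists_eventually_mul_norm_sub_le :
    ∃ m > 0, ∀ᶠ w in 𝓝 x, (clarkeJacobian f w).Nonempty → m * ‖w - x‖ ≤ ‖f w‖ := by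
  obtain ⟨m, hm, hlow⟩ := eventually_forall_clarkeJacobian_mul_norm_le hf hinj
  obtain ⟨C, hC⟩ := hsemi.eventually_forall_clarkeJacobian hf.continuous
  refine ⟨m / 2, half_pos hm, ?_⟩
  filter_upwards [hlow, hC, eventually_mul_norm_sub_lt x C (half_pos hm)]
    with w hlow hC hsmall ⟨J, hJ⟩
  have hlinear := hlow J hJ (w - x)
  have herror : ‖f w - J (w - x)‖ ≤ C * ‖w - x‖ * ‖w - x‖ := by
    simpa [hx, sq, mul_assoc] using hC J hJ
  have habsorb := mul_le_mul_of_nonneg_right hsmall.le (norm_nonneg (w - x))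
  linarith [norm_sub_norm_le (J (w - x)) (f w), norm_sub_rev (J (w - x)) (f w)]

theorem exists_eventually_norm_add_sub_le_sq {a : ℝ} (ha : 0 ≤ a) :
    ∃ B, 0 ≤ B ∧ ∀ᶠ w in 𝓝 x, ∀ J ∈ clarkeJacobian f w, ∀ Δ,
      ‖J Δ + f w‖ ≤ a * ‖w - x‖ * ‖Δ‖ → ‖w + Δ - x‖ ≤ B * ‖w - x‖ ^ 2 := by
  obtain ⟨m, hm, hlow⟩ := eventually_forall_clarkeJacobian_mul_norm_le hf hinj
  obtain ⟨C, hC⟩ := hsemi.eventually_forall_clarkeJacobian hf.continuous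
  refine ⟨2 * (|C| + a) / m, by positivity, ?_⟩
  filter_upwards [hlow, hC, eventually_mul_norm_sub_lt x a (half_pos hm)]
    with w hlow hC hsmall J hJ Δ hΔ
  have hsplit : J (w + Δ - x) = (J Δ + f w) - (f w - f x - J (w - x)) := by
    rw [hx, sub_zero, add_sub_right_comm, map_add]; abel
  have hlinear : m * ‖w + Δ - x‖ ≤ a * ‖w - x‖ * ‖Δ‖ + |C| * ‖w - x‖ ^ 2 :=
    calc m * ‖w + Δ - x‖ ≤ ‖(J Δ + f w) - (f w - f x - J (w - x))‖ := hsplit ▸ hlow J hJ _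
      _ ≤ ‖J Δ + f w‖ + ‖f w - f x - J (w - x)‖ := norm_sub_le _ _
      _ ≤ _ := add_le_add hΔ
        ((hC J hJ).trans (mul_le_mul_of_nonneg_right (le_abs_self C) (sq_nonneg _)))
  have hstep : ‖Δ‖ ≤ ‖w + Δ - x‖ + ‖w - x‖ := by
    simpa using norm_sub_le (w + Δ - x) (w - x)
  have hstep' := mul_le_mul_of_nonneg_left hstep (mul_nonneg ha (norm_nonneg (w - x)))
  have habsorb := mul_le_mul_of_nonneg_right hsmall.le (norm_nonneg (w + Δ - x))
  rw [div_mul_eq_mul_div, le_div_iff₀ hm]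
  linarith

theorem exists_eventually_newton_step {a : ℝ} (ha : 0 ≤ a) {c : ℝ} (hc : 0 < c) :
    ∃ C, ∀ᶠ w in 𝓝 x, ∀ J ∈ clarkeJacobian f w, ∀ Δ, ‖J Δ + f w‖ ≤ a * ‖w - x‖ * ‖Δ‖ →
      ‖w + Δ - x‖ ≤ ‖w - x‖ ∧ ‖f (w + Δ)‖ ≤ C * ‖f w‖ ^ 2 ∧ ‖f (w + Δ)‖ ≤ c * ‖Δ‖ := by
  obtain ⟨m, hm, hbound⟩ := exists_eventually_mul_norm_sub_le hf hsemi hx hinj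
  obtain ⟨B, hB, hquad⟩ := exists_eventually_norm_add_sub_le_sq hf hsemi hx hinj ha
  have hlip (u : E) : ‖f u‖ ≤ K * ‖u - x‖ := by simpa [hx] using hf.norm_sub_le u x
  refine ⟨K * B / m ^ 2, ?_⟩
  filter_upwards [hbound, hquad, eventually_mul_norm_sub_lt x B one_half_pos,
    eventually_mul_norm_sub_lt x (2 * (K * B)) hc] with w hbound hquad hhalf hsmall J hJ Δ hΔ
  have hnext := hquad J hJ Δ hΔ
  have hnextf : ‖f (w + Δ)‖ ≤ K * (B * ‖w - x‖ ^ 2) :=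
    (hlip _).trans (mul_le_mul_of_nonneg_left hnext K.coe_nonneg)
  have hcloser : ‖w + Δ - x‖ ≤ 1 / 2 * ‖w - x‖ :=
    calc ‖w + Δ - x‖ ≤ B * ‖w - x‖ * ‖w - x‖ := hnext.trans_eq (by ring)
      _ ≤ _ := mul_le_mul_of_nonneg_right hhalf.le (norm_nonneg _)
  have hdist : ‖w - x‖ ≤ 2 * ‖Δ‖ := by
    have htriangle : ‖w - x‖ ≤ ‖w + Δ - x‖ + ‖Δ‖ := by
      simpa [add_sub_right_comm] using norm_sub_le (w + Δ - x) Δ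
    linarith
  refine ⟨by linarith [norm_nonneg (w - x)], ?_, ?_⟩
  · calc ‖f (w + Δ)‖ ≤ K * (B * ‖w - x‖ ^ 2) := hnextf
      _ = K * B / m ^ 2 * (m * ‖w - x‖) ^ 2 := by field_simp
      _ ≤ K * B / m ^ 2 * ‖f w‖ ^ 2 := by gcongr; exact hbound ⟨J, hJ⟩
  · calc ‖f (w + Δ)‖ ≤ K * B * ‖w - x‖ * ‖w - x‖ := hnextf.trans_eq (by ring)
      _ ≤ K * B * ‖w - x‖ * (2 * ‖Δ‖) := by gcongr
      _ = 2 * (K * B) * ‖w - x‖ * ‖Δ‖ := by ring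
      _ ≤ c * ‖Δ‖ := mul_le_mul_of_nonneg_right hsmall.le (norm_nonneg _)

end Newton

/-! ### Metric projections and extragradient steps -/

section Hilbert

variable {H : Type*} [NormedAddCommGroup H] [InnerProductSpace ℝ H]

theorem forall_norm_sub_le_iff_inner_le_zero {S : Set H} (hS : Convex ℝ S) {z p : H} (hp : p ∈ S) :
    (∀ s ∈ S, ‖z - p‖ ≤ ‖z - s‖) ↔ ∀ s ∈ S, inner ℝ (z - p) (s - p) ≤ 0 := by
  rw [← norm_eq_iInf_iff_real_inner_le_zero hS hp]
  have : Nonempty S := ⟨⟨p, hp⟩⟩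
  have hbdd : BddBelow (Set.range fun s : S => ‖z - s‖) :=
    ⟨0, Set.forall_mem_range.mpr fun _ => norm_nonneg _⟩
  exact ⟨fun h => le_antisymm (le_ciInf fun s => h s s.2) (ciInf_le hbdd ⟨p, hp⟩),
    fun h s hs => h.trans_le (ciInf_le hbdd ⟨s, hs⟩)⟩

theorem norm_sub_sq_le_inner_of_inner_le_zero {z y p q : H} (hp : inner ℝ (z - p) (q - p) ≤ 0)
    (hq : inner ℝ (y - q) (p - q) ≤ 0) : ‖p - q‖ ^ 2 ≤ inner ℝ (z - y) (p - q) := by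
  have hsplit : inner ℝ (z - y) (p - q) =
      ‖p - q‖ ^ 2 - inner ℝ (z - p) (q - p) - inner ℝ (y - q) (p - q) := by
    rw [← real_inner_self_eq_norm_sq, ← neg_sub p q, inner_neg_right, sub_neg_eq_add,
      ← inner_add_left, ← inner_sub_left]
    congr 1; abel
  linarith

theorem norm_le_of_sq_le_inner {a b : H} (h : ‖a‖ ^ 2 ≤ inner ℝ b a) : ‖a‖ ≤ ‖b‖ := by
  nlinarith [real_inner_le_norm b a, norm_nonneg a, norm_nonneg b]

theorem norm_sub_le_of_sq_le_inner {a b : H} (h : ‖a‖ ^ 2 ≤ inner ℝ b a) : ‖a - b‖ ≤ ‖b‖ := by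
  refine le_of_sq_le_sq ?_ (norm_nonneg b)
  rw [norm_sub_sq_real, real_inner_comm]
  nlinarith [sq_nonneg ‖a‖]

theorem norm_extragradient_sub_le {v y v' x g g' : H} {η L : ℝ} (hη : 0 ≤ η) (hL : η * L ≤ 1)
    (hv' : inner ℝ (v - η • g' - v') (x - v') ≤ 0) (hy : inner ℝ (v - η • g - y) (v' - y) ≤ 0)
    (hg' : 0 ≤ inner ℝ g' (y - x)) (hLip : ‖g' - g‖ ≤ L * ‖y - v‖) : ‖v' - x‖ ≤ ‖v - x‖ := by
  refine le_of_sq_le_sq ?_ (norm_nonneg _)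
  have hexpand : ‖v' - x‖ ^ 2 = ‖v - x‖ ^ 2 - ‖v - y‖ ^ 2 - ‖y - v'‖ ^ 2
      + 2 * inner ℝ (v - η • g' - v') (x - v') + 2 * inner ℝ (v - η • g - y) (v' - y)
      - 2 * (η * inner ℝ g' (y - x)) + 2 * (η * inner ℝ (g' - g) (y - v')) := by
    simp only [← real_inner_self_eq_norm_sq, inner_sub_left, inner_sub_right, real_inner_smul_left]
    rw [real_inner_comm x v', real_inner_comm y v', real_inner_comm x v, real_inner_comm y v]
    ring
  have herror : η * inner ℝ (g' - g) (y - v') ≤ ‖v - y‖ * ‖y - v'‖ :=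
    calc η * inner ℝ (g' - g) (y - v') ≤ η * (L * ‖y - v‖ * ‖y - v'‖) :=
          mul_le_mul_of_nonneg_left ((real_inner_le_norm _ _).trans
            (mul_le_mul_of_nonneg_right hLip (norm_nonneg _))) hη
      _ = η * L * (‖v - y‖ * ‖y - v'‖) := by rw [norm_sub_rev y v]; ring
      _ ≤ ‖v - y‖ * ‖y - v'‖ := mul_le_of_le_one_left (by positivity) hL
  nlinarith [mul_nonneg hη hg', sq_nonneg (‖v - y‖ - ‖y - v'‖)]

end Hilbert

/-! ### Matrices as operators -/

section Matrices

variable {n : ℕ}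

/-- The operator on the Euclidean space given by a matrix. -/
def act : FrobMat n →ₗ[ℝ] EuclideanSpace ℝ (Fin n) →ₗ[ℝ] EuclideanSpace ℝ (Fin n) where
  toFun X := Matrix.toEuclideanLin (toMat X)
  map_add' X Y := map_add Matrix.toEuclideanLin (toMat X) (toMat Y)
  map_smul' c X := map_smul Matrix.toEuclideanLin c (toMat X)

theorem act_apply (X : FrobMat n) (u : EuclideanSpace ℝ (Fin n)) (i : Fin n) :
    act X u i = ∑ j, X (i, j) * u j := rfl

theorem act_injective : Function.Injective (act : FrobMat n → _) := by
  intro X Y h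
  ext q
  exact congrFun (congrFun (Matrix.toEuclideanLin.injective h) q.1) q.2

theorem posSemidef_toMat_iff {X : FrobMat n} : (toMat X).PosSemidef ↔ (act X).IsPositive :=
  Matrix.isPositive_toEuclideanLin_iff.symm

theorem convex_posSemidef : Convex ℝ {X : FrobMat n | (toMat X).PosSemidef} :=
  fun _ hX _ hY _ _ ha hb _ => (hX.smul ha).add (hY.smul hb)

/-- The rank-one matrix `u vᵀ`. -/
def outer (u v : EuclideanSpace ℝ (Fin n)) : FrobMat n := ofMat (Matrix.vecMulVec u v)

theorem outer_apply (u v : EuclideanSpace ℝ (Fin n)) (q : Fin n × Fin n) :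
    outer u v q = u q.1 * v q.2 := rfl

theorem inner_outer (u v : EuclideanSpace ℝ (Fin n)) (X : FrobMat n) :
    inner ℝ (outer u v) X = inner ℝ u (act X v) := by
  simp only [PiLp.inner_apply, Fintype.sum_prod_type, outer_apply, act_apply, RCLike.inner_apply,
    conj_trivial, Finset.sum_mul]
  exact Finset.sum_congr rfl fun i _ => Finset.sum_congr rfl fun j _ => by ring

theorem act_outer (a b u : EuclideanSpace ℝ (Fin n)) : act (outer a b) u = inner ℝ b u • a := by
  ext i
  simp only [act_apply, outer_apply, PiLp.smul_apply, PiLp.inner_apply, RCLike.inner_apply,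
    conj_trivial, smul_eq_mul, Finset.sum_mul]
  exact Finset.sum_congr rfl fun j _ => by ring

theorem norm_outer (u v : EuclideanSpace ℝ (Fin n)) : ‖outer u v‖ = ‖u‖ * ‖v‖ := by
  rw [← sq_eq_sq₀ (norm_nonneg _) (by positivity), ← real_inner_self_eq_norm_sq, inner_outer,
    act_outer, real_inner_smul_right, real_inner_self_eq_norm_sq, real_inner_self_eq_norm_sq]
  ring

theorem norm_act_le (X : FrobMat n) (u : EuclideanSpace ℝ (Fin n)) : ‖act X u‖ ≤ ‖X‖ * ‖u‖ := by
  rcases eq_or_ne (act X u) 0 with h | h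
  · rw [h, norm_zero]; positivity
  refine le_of_mul_le_mul_left ?_ (norm_pos_iff.mpr h)
  calc ‖act X u‖ * ‖act X u‖ = inner ℝ (outer (act X u) u) X := by
        rw [inner_outer, real_inner_self_eq_norm_mul_norm]
    _ ≤ ‖outer (act X u) u‖ * ‖X‖ := real_inner_le_norm _ _
    _ = ‖act X u‖ * (‖X‖ * ‖u‖) := by rw [norm_outer]; ring

theorem abs_inner_act_act_le (X Y : FrobMat n) {u v : EuclideanSpace ℝ (Fin n)} (hu : ‖u‖ = 1)
    (hv : ‖v‖ = 1) : |inner ℝ (act X u) (act Y v)| ≤ ‖X‖ * ‖Y‖ := by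
  refine (abs_real_inner_le_norm _ _).trans ?_
  gcongr
  · simpa [hu] using norm_act_le X u
  · simpa [hv] using norm_act_le Y v

/-- The subspace of symmetric matrices. -/
def symmetricMats (n : ℕ) : Submodule ℝ (FrobMat n) where
  carrier := {X | (act X).IsSymmetric}
  add_mem' hX hY := by simpa using hX.add hY
  zero_mem' := by simp
  smul_mem' c X hX := by simpa using hX.smul (c := c) rfl

theorem inner_act_comm {X : FrobMat n} (hX : X ∈ symmetricMats n) (u v : EuclideanSpace ℝ (Fin n)) :
    inner ℝ (act X u) v = inner ℝ u (act X v) := hX u v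

theorem mem_symmetricMats_of_posSemidef {X : FrobMat n} (hX : (toMat X).PosSemidef) :
    X ∈ symmetricMats n := (posSemidef_toMat_iff.mp hX).isSymmetric

section OrthonormalBasis

variable (q : OrthonormalBasis (Fin n) ℝ (EuclideanSpace ℝ (Fin n)))

/-- The matrix entry `⟨qᵢ, X qⱼ⟩` in an orthonormal basis, as a functional of `X`. -/
def entry (i j : Fin n) : FrobMat n →L[ℝ] ℝ := innerSL ℝ (outer (q i) (q j))

theorem entry_apply (i j : Fin n) (X : FrobMat n) : entry q i j X = inner ℝ (q i) (act X (q j)) :=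
  inner_outer _ _ _

theorem entry_comm {X : FrobMat n} (hX : X ∈ symmetricMats n) (i j : Fin n) :
    entry q i j X = entry q j i X := by
  rw [entry_apply, entry_apply, real_inner_comm, inner_act_comm hX]

theorem entry_self_nonneg {X : FrobMat n} (hX : (toMat X).PosSemidef) (i : Fin n) :
    0 ≤ entry q i i X := by
  rw [entry_apply]
  exact (posSemidef_toMat_iff.mp hX).inner_nonneg_right (q i)

theorem eq_of_act_basis_eq {X Y : FrobMat n} (h : ∀ i, act X (q i) = act Y (q i)) : X = Y :=
  act_injective (q.toBasis.ext fun i => by simpa using h i)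

theorem sum_entry_smul_outer (X : FrobMat n) :
    ∑ i, ∑ j, entry q i j X • outer (q i) (q j) = X := by
  refine eq_of_act_basis_eq q fun k => ?_
  simp [act_outer, entry_apply, q.inner_eq_ite, q.sum_repr']

theorem norm_le_of_abs_entry_le {X : FrobMat n} {c : ℝ} (h : ∀ i j, |entry q i j X| ≤ c) :
    ‖X‖ ≤ n ^ 2 * c :=
  calc ‖X‖ = ‖∑ i, ∑ j, entry q i j X • outer (q i) (q j)‖ := by rw [sum_entry_smul_outer]
    _ ≤ ∑ _ : Fin n, ∑ _ : Fin n, c := norm_sum_le_of_le _ fun i _ =>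
        norm_sum_le_of_le _ fun j _ => by simpa [norm_smul, norm_outer] using h i j
    _ = n ^ 2 * c := by simp; ring

/-- The symmetric matrix with eigenvectors `q` and eigenvalues `c`. -/
def spectralMat : (Fin n → ℝ) →ₗ[ℝ] FrobMat n :=
  Fintype.linearCombination ℝ fun i => outer (q i) (q i)

theorem spectralMat_apply (c : Fin n → ℝ) : spectralMat q c = ∑ i, c i • outer (q i) (q i) := rfl

theorem act_spectralMat (c : Fin n → ℝ) (j : Fin n) : act (spectralMat q c) (q j) = c j • q j := by
  simp [spectralMat_apply, act_outer, q.inner_eq_ite]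

theorem inner_spectralMat (c : Fin n → ℝ) (X : FrobMat n) :
    inner ℝ (spectralMat q c) X = ∑ i, c i * entry q i i X := by
  simp [spectralMat_apply, sum_inner, real_inner_smul_left, entry]

theorem entry_spectralMat_self (c : Fin n → ℝ) (i : Fin n) :
    entry q i i (spectralMat q c) = c i := by
  simp [entry_apply, act_spectralMat, real_inner_smul_right]

theorem outer_self_mem_symmetricMats (u : EuclideanSpace ℝ (Fin n)) :
    outer u u ∈ symmetricMats n := fun v w => by
  simp only [act_outer, real_inner_smul_left, real_inner_smul_right, real_inner_comm u v]
  ring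

theorem spectralMat_mem_symmetricMats (c : Fin n → ℝ) : spectralMat q c ∈ symmetricMats n :=
  Submodule.sum_mem _ fun i _ => Submodule.smul_mem _ _ (outer_self_mem_symmetricMats (q i))

theorem posSemidef_spectralMat {c : Fin n → ℝ} (hc : 0 ≤ c) :
    (toMat (spectralMat q c)).PosSemidef := by
  refine posSemidef_toMat_iff.mpr ⟨spectralMat_mem_symmetricMats q c, fun u => ?_⟩
  rw [RCLike.re_to_real, real_inner_comm, ← inner_outer, real_inner_comm, inner_spectralMat]
  refine Finset.sum_nonneg fun i _ => mul_nonneg (hc i) ?_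
  rw [entry_apply, act_outer, real_inner_smul_right, real_inner_comm]
  exact mul_self_nonneg _

theorem exists_eq_spectralMat {A : FrobMat n} (hA : A ∈ symmetricMats n) :
    ∃ (q : OrthonormalBasis (Fin n) ℝ (EuclideanSpace ℝ (Fin n))) (c : Fin n → ℝ),
      A = spectralMat q c := by
  have hA' : (act A).IsSymmetric := hA
  let q := hA'.eigenvectorBasis finrank_euclideanSpace_fin
  refine ⟨q, hA'.eigenvalues finrank_euclideanSpace_fin, eq_of_act_basis_eq q fun i => ?_⟩
  rw [act_spectralMat]
  exact hA'.apply_eigenvectorBasis finrank_euclideanSpace_fin i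

theorem inner_act_add_inner_act_spectralMat {X : FrobMat n} (hX : X ∈ symmetricMats n)
    (a b : Fin n → ℝ) (i j : Fin n) :
    inner ℝ (act X (q i)) (act (spectralMat q a) (q j))
      + inner ℝ (act (spectralMat q b) (q i)) (act X (q j)) = (a j + b i) * entry q i j X := by
  rw [act_spectralMat, act_spectralMat, real_inner_smul_right, real_inner_smul_left,
    inner_act_comm hX, entry_apply]
  ring

end OrthonormalBasis

end Matrices

/-! ### The projection onto the positive semidefinite cone -/

section Projection

variable {n : ℕ}

theorem posSemidef_projPSD (Z : FrobMat n) : (toMat (projPSD Z)).PosSemidef :=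
  (existsUnique_nearest_psd Z).choose_spec.1.1

theorem projPSD_mem_symmetricMats (Z : FrobMat n) : projPSD Z ∈ symmetricMats n :=
  mem_symmetricMats_of_posSemidef (posSemidef_projPSD Z)

theorem inner_sub_projPSD_le_zero (Z : FrobMat n) {S : FrobMat n} (hS : (toMat S).PosSemidef) :
    inner ℝ (Z - projPSD Z) (S - projPSD Z) ≤ 0 :=
  (forall_norm_sub_le_iff_inner_le_zero convex_posSemidef (posSemidef_projPSD Z)).mp
    (existsUnique_nearest_psd Z).choose_spec.1.2 S hS

theorem projPSD_eq_of_inner_le_zero {Z P : FrobMat n} (hP : (toMat P).PosSemidef)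
    (h : ∀ S : FrobMat n, (toMat S).PosSemidef → inner ℝ (Z - P) (S - P) ≤ 0) : projPSD Z = P :=
  (existsUnique_nearest_psd Z).unique (existsUnique_nearest_psd Z).choose_spec.1
    ⟨hP, (forall_norm_sub_le_iff_inner_le_zero convex_posSemidef hP).mpr h⟩

theorem norm_projPSD_sub_sq_le (Z Y : FrobMat n) :
    ‖projPSD Z - projPSD Y‖ ^ 2 ≤ inner ℝ (Z - Y) (projPSD Z - projPSD Y) :=
  norm_sub_sq_le_inner_of_inner_le_zero (inner_sub_projPSD_le_zero Z (posSemidef_projPSD Y))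
    (inner_sub_projPSD_le_zero Y (posSemidef_projPSD Z))

theorem norm_projPSD_sub_le (Z Y : FrobMat n) : ‖projPSD Z - projPSD Y‖ ≤ ‖Z - Y‖ :=
  norm_le_of_sq_le_inner (norm_projPSD_sub_sq_le Z Y)

theorem norm_projPSD_sub_self_sub_le (Z Y : FrobMat n) :
    ‖(projPSD Z - Z) - (projPSD Y - Y)‖ ≤ ‖Z - Y‖ := by
  rw [sub_sub_sub_comm]
  exact norm_sub_le_of_sq_le_inner (norm_projPSD_sub_sq_le Z Y)

theorem projPSD_smul {t : ℝ} (ht : 0 < t) (Z : FrobMat n) :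
    projPSD (t • Z) = t • projPSD Z := by
  refine projPSD_eq_of_inner_le_zero ((posSemidef_projPSD Z).smul ht.le) fun S hS => ?_
  have hscale : S - t • projPSD Z = t • (t⁻¹ • S - projPSD Z) := by
    rw [smul_sub, smul_inv_smul₀ ht.ne']
  rw [← smul_sub, hscale, real_inner_smul_left, real_inner_smul_right]
  have h := inner_sub_projPSD_le_zero Z (S := t⁻¹ • S) (hS.smul (inv_nonneg.mpr ht.le))
  exact mul_nonpos_of_nonneg_of_nonpos ht.le (mul_nonpos_of_nonneg_of_nonpos ht.le h)

theorem projPSD_starProjection_symmetricMats (Z : FrobMat n) :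
    projPSD ((symmetricMats n).starProjection Z) = projPSD Z := by
  refine projPSD_eq_of_inner_le_zero (posSemidef_projPSD Z) fun S hS => ?_
  have horth : inner ℝ (Z - (symmetricMats n).starProjection Z) (S - projPSD Z) = 0 :=
    Submodule.starProjection_inner_eq_zero Z _
      (sub_mem (mem_symmetricMats_of_posSemidef hS) (projPSD_mem_symmetricMats Z))
  calc inner ℝ ((symmetricMats n).starProjection Z - projPSD Z) (S - projPSD Z)
      = inner ℝ (Z - projPSD Z) (S - projPSD Z) := by
        rw [← sub_eq_zero, ← inner_sub_left, sub_sub_sub_cancel_right, ← neg_sub, inner_neg_left,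
          horth, neg_zero]
    _ ≤ 0 := inner_sub_projPSD_le_zero Z hS

theorem posPart_mul_negPart_eq_zero {ι : Type*} (c : ι → ℝ) : c⁺ * c⁻ = 0 := by
  ext i
  rcases le_total 0 (c i) with h | h <;> simp [h]

section Spectral

variable (q : OrthonormalBasis (Fin n) ℝ (EuclideanSpace ℝ (Fin n)))

theorem spectralMat_posPart_sub_self (c : Fin n → ℝ) :
    spectralMat q c⁺ - spectralMat q c = spectralMat q c⁻ := by
  rw [sub_eq_iff_eq_add', ← map_add, ← sub_eq_iff_eq_add.mp (posPart_sub_negPart c)]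

theorem projPSD_spectralMat (c : Fin n → ℝ) : projPSD (spectralMat q c) = spectralMat q c⁺ := by
  refine projPSD_eq_of_inner_le_zero (posSemidef_spectralMat q (posPart_nonneg c)) fun S hS => ?_
  rw [← neg_sub, spectralMat_posPart_sub_self, inner_neg_left, inner_spectralMat, neg_nonpos]
  refine Finset.sum_nonneg fun i _ => ?_
  have horth : c⁻ i * c⁺ i = 0 := mul_comm (c⁺ i) _ ▸ congrFun (posPart_mul_negPart_eq_zero c) i
  rw [map_sub, entry_spectralMat_self, mul_sub, horth, sub_zero]
  exact mul_nonneg (negPart_nonneg c i) (entry_self_nonneg q hS i)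

theorem act_spectralMat_comp (a b : Fin n → ℝ) (v : EuclideanSpace ℝ (Fin n)) :
    act (spectralMat q a) (act (spectralMat q b) v) = act (spectralMat q (a * b)) v := by
  suffices h : act (spectralMat q a) ∘ₗ act (spectralMat q b) = act (spectralMat q (a * b)) from
    LinearMap.congr_fun h v
  refine q.toBasis.ext fun i => ?_
  simp [act_spectralMat, smul_smul, mul_comm]

end Spectral

theorem inner_act_projPSD_act_sub_self_eq_zero {A : FrobMat n} (hA : A ∈ symmetricMats n)
    (u v : EuclideanSpace ℝ (Fin n)) :
    inner ℝ (act (projPSD A) u) (act (projPSD A - A) v) = 0 := by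
  obtain ⟨q, c, rfl⟩ := exists_eq_spectralMat hA
  rw [inner_act_comm (projPSD_mem_symmetricMats _), projPSD_spectralMat,
    spectralMat_posPart_sub_self, act_spectralMat_comp, posPart_mul_negPart_eq_zero, map_zero,
    map_zero, LinearMap.zero_apply, inner_zero_right]

end Projection

/-! ### Strong semismoothness of the projection -/

section Derivative

variable {n : ℕ} {A B A₀ : FrobMat n} {P' : FrobMat n →L[ℝ] FrobMat n}

theorem fderiv_projPSD_mem_symmetricMats (hP : HasFDerivAt projPSD P' A) (B : FrobMat n) :
    P' B ∈ symmetricMats n := by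
  have hπ : HasFDerivAt projPSD ((symmetricMats n).starProjection ∘L P') A := by
    refine ((symmetricMats n).starProjection.hasFDerivAt.comp A hP).congr_of_eventuallyEq
      (Eventually.of_forall fun Z => ?_)
    exact (Submodule.starProjection_eq_self_iff.mpr (projPSD_mem_symmetricMats Z)).symm
  exact Submodule.starProjection_eq_self_iff.mp (DFunLike.congr_fun (hπ.unique hP) B)

theorem fderiv_projPSD_self (hP : HasFDerivAt projPSD P' A) : P' A = projPSD A := by
  have hline : HasDerivAt (fun t : ℝ => t • A) A 1 := by
    simpa using (hasDerivAt_id (1 : ℝ)).smul_const A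
  have hcomp : HasDerivAt (fun t : ℝ => projPSD (t • A)) (P' A) 1 :=
    hP.comp_hasDerivAt_of_eq 1 hline (one_smul ℝ A).symm
  have hlin : HasDerivAt (fun t : ℝ => t • projPSD A) (projPSD A) 1 := by
    simpa using (hasDerivAt_id (1 : ℝ)).smul_const (projPSD A)
  refine hcomp.unique (hlin.congr_of_eventuallyEq ?_)
  filter_upwards [Ioi_mem_nhds one_pos] with t ht using projPSD_smul ht A

theorem hasDerivAt_act_apply {g : ℝ → FrobMat n} {g' : FrobMat n} {t : ℝ} (hg : HasDerivAt g g' t)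
    (u : EuclideanSpace ℝ (Fin n)) : HasDerivAt (fun s => act (g s) u) (act g' u) t :=
  (act.flip u).toContinuousLinearMap.hasFDerivAt.comp_hasDerivAt t hg

theorem inner_act_fderiv_projPSD_add (hP : HasFDerivAt projPSD P' A) (hA : A ∈ symmetricMats n)
    (hB : B ∈ symmetricMats n) (u v : EuclideanSpace ℝ (Fin n)) :
    inner ℝ (act (P' B) u) (act (projPSD A - A) v)
      + inner ℝ (act (projPSD A) u) (act (P' B - B) v) = 0 := by
  have hline : HasDerivAt (fun t : ℝ => A + t • B) B 0 := by
    simpa using ((hasDerivAt_id (0 : ℝ)).smul_const B).const_add A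
  have hproj : HasDerivAt (fun t : ℝ => projPSD (A + t • B)) (P' B) 0 := hP.hasLineDerivAt B
  have hprod := (hasDerivAt_act_apply hproj u).inner ℝ (hasDerivAt_act_apply (hproj.sub hline) v)
  have hzero (t : ℝ) : inner ℝ (act (projPSD (A + t • B)) u)
      (act (projPSD (A + t • B) - (A + t • B)) v) = 0 :=
    inner_act_projPSD_act_sub_self_eq_zero (add_mem hA (Submodule.smul_mem _ t hB)) u v
  have hderiv := hprod.unique ((hasDerivAt_const (0 : ℝ) (0 : ℝ)).congr_of_eventuallyEq
    (Eventually.of_forall hzero))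
  rw [Pi.sub_apply, zero_smul, add_zero, add_comm] at hderiv
  exact hderiv

theorem inner_act_fderiv_projPSD_sub_add (hP : HasFDerivAt projPSD P' A)
    (hA : A ∈ symmetricMats n) (hA₀ : A₀ ∈ symmetricMats n) (u v : EuclideanSpace ℝ (Fin n)) :
    inner ℝ (act (P' A₀ - projPSD A₀) u) (act (projPSD A - A) v)
      + inner ℝ (act (projPSD A) u) (act (P' A₀ - projPSD A₀) v)
      = inner ℝ (act (projPSD A - projPSD A₀) u)
        (act ((projPSD A - A) - (projPSD A₀ - A₀)) v) := by
  have hderiv := inner_act_fderiv_projPSD_add hP hA hA₀ u v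
  have horth := inner_act_projPSD_act_sub_self_eq_zero hA u v
  have horth₀ := inner_act_projPSD_act_sub_self_eq_zero hA₀ u v
  simp only [map_sub, LinearMap.sub_apply, inner_sub_left, inner_sub_right] at *
  linarith

section Eigenbasis

variable (q : OrthonormalBasis (Fin n) ℝ (EuclideanSpace ℝ (Fin n))) {c : Fin n → ℝ}

theorem entry_fderiv_projPSD (hP : HasFDerivAt projPSD P' (spectralMat q c))
    (hB : B ∈ symmetricMats n) (i j : Fin n) :
    (|c i| + |c j|) * entry q i j (P' B) = ((c i)⁺ + (c j)⁺) * entry q i j B := by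
  have hV := fderiv_projPSD_mem_symmetricMats hP B
  have hone (i j : Fin n) :
      ((c j)⁻ + (c i)⁺) * entry q i j (P' B) = (c i)⁺ * entry q i j B := by
    have h := inner_act_fderiv_projPSD_add hP (spectralMat_mem_symmetricMats q c) hB (q i) (q j)
    rw [projPSD_spectralMat, spectralMat_posPart_sub_self, map_sub, LinearMap.sub_apply,
      inner_sub_right, ← add_sub_assoc, inner_act_add_inner_act_spectralMat q hV, sub_eq_zero,
      act_spectralMat, real_inner_smul_left, ← entry_apply] at h
    exact h
  have hji := hone j i
  rw [entry_comm q hV, entry_comm q hB] at hji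
  rw [← posPart_add_negPart, ← posPart_add_negPart]
  linarith [hone i j]

theorem abs_entry_fderiv_projPSD_le (hP : HasFDerivAt projPSD P' (spectralMat q c))
    (hB : B ∈ symmetricMats n) {i : Fin n} (hi : c i ≠ 0) (j : Fin n) :
    |entry q i j (P' B)| ≤ |entry q i j B| := by
  have hle (x : ℝ) : x⁺ ≤ |x| := sup_le (le_abs_self x) (abs_nonneg x)
  have hpos : 0 < |c i| + |c j| := by positivity
  refine le_of_mul_le_mul_left ?_ hpos
  calc (|c i| + |c j|) * |entry q i j (P' B)| = ((c i)⁺ + (c j)⁺) * |entry q i j B| := by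
        rw [← abs_of_pos hpos, ← abs_mul, entry_fderiv_projPSD q hP hB, abs_mul,
          abs_of_nonneg (add_nonneg (posPart_nonneg _) (posPart_nonneg _))]
    _ ≤ (|c i| + |c j|) * |entry q i j B| := by gcongr <;> exact hle _

theorem abs_entry_fderiv_projPSD_sub_le (hP : HasFDerivAt projPSD P' (spectralMat q c))
    (hA₀ : A₀ ∈ symmetricMats n) (i j : Fin n) :
    (|c i| + |c j|) * |entry q i j (P' A₀ - projPSD A₀)| ≤ 2 * ‖spectralMat q c - A₀‖ ^ 2 := by
  set E := P' A₀ - projPSD A₀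
  have hE : E ∈ symmetricMats n :=
    sub_mem (fderiv_projPSD_mem_symmetricMats hP A₀) (projPSD_mem_symmetricMats A₀)
  have hone (i j : Fin n) : |((c j)⁻ + (c i)⁺) * entry q i j E| ≤ ‖spectralMat q c - A₀‖ ^ 2 := by
    have h := inner_act_fderiv_projPSD_sub_add hP (spectralMat_mem_symmetricMats q c) hA₀
      (q i) (q j)
    rw [projPSD_spectralMat, spectralMat_posPart_sub_self,
      inner_act_add_inner_act_spectralMat q hE, ← spectralMat_posPart_sub_self,
      ← projPSD_spectralMat] at h
    rw [← Pi.negPart_apply, ← Pi.posPart_apply, h, sq]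
    refine (abs_inner_act_act_le _ _ (q.norm_eq_one i) (q.norm_eq_one j)).trans ?_
    gcongr
    exacts [norm_projPSD_sub_le _ _, norm_projPSD_sub_self_sub_le _ _]
  have hpos : 0 ≤ |c i| + |c j| := by positivity
  calc (|c i| + |c j|) * |entry q i j E|
      = |((c j)⁻ + (c i)⁺) * entry q i j E + ((c i)⁻ + (c j)⁺) * entry q j i E| := by
        rw [← abs_of_nonneg hpos, ← abs_mul, entry_comm q hE j i, ← posPart_add_negPart (c i),
          ← posPart_add_negPart (c j)]
        congr 1; ring
    _ ≤ 2 * ‖spectralMat q c - A₀‖ ^ 2 := by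
        linarith [abs_add_le (((c j)⁻ + (c i)⁺) * entry q i j E)
          (((c i)⁻ + (c j)⁺) * entry q j i E), hone i j, hone j i]

theorem eigenvalue_ne_zero_of_differentiableAt_projPSD
    (hP : DifferentiableAt ℝ projPSD (spectralMat q c)) (i : Fin n) : c i ≠ 0 := by
  intro hi
  have hentry (t : ℝ) : 2 * entry q i i
      (projPSD (spectralMat q c + t • spectralMat q (Pi.single i 1))) - t = |t| := by
    rw [← map_smul, ← map_add, projPSD_spectralMat, entry_spectralMat_self]
    rcases le_total 0 t with h | h <;> simp [hi, h, abs_of_nonneg, abs_of_nonpos]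
    ring
  have hline := (hP.hasFDerivAt.hasLineDerivAt (spectralMat q (Pi.single i 1))).differentiableAt
  refine not_differentiableAt_abs_zero (DifferentiableAt.congr_of_eventuallyEq ?_
    (Eventually.of_forall fun t => (hentry t).symm))
  exact (((entry q i i).differentiableAt.comp (0 : ℝ) hline).const_mul 2).sub differentiableAt_id

end Eigenbasis

end Derivative

section Semismooth

variable {n : ℕ} (p q : OrthonormalBasis (Fin n) ℝ (EuclideanSpace ℝ (Fin n))) {b c : Fin n → ℝ}

theorem abs_sub_mul_abs_inner_eigenvector_le (k i : Fin n) :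
    |b k - c i| * |inner ℝ (p k) (q i)| ≤ ‖spectralMat q c - spectralMat p b‖ := by
  have hinner : (b k - c i) * inner ℝ (p k) (q i) =
      -inner ℝ (p k) (act (spectralMat q c - spectralMat p b) (q i)) := by
    rw [map_sub, LinearMap.sub_apply, act_spectralMat, inner_sub_right, real_inner_smul_right,
      ← inner_act_comm (spectralMat_mem_symmetricMats p b), act_spectralMat, real_inner_smul_left]
    ring
  rw [← abs_mul, hinner, abs_neg]
  refine (abs_real_inner_le_norm _ _).trans ?_
  simpa using norm_act_le (spectralMat q c - spectralMat p b) (q i)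

theorem abs_inner_eigenvector_le {r : ℝ} (hr : 0 < r) {k i : Fin n} (hb : 2 * r ≤ |b k|)
    (hc : |c i| < r) : |inner ℝ (p k) (q i)| ≤ ‖spectralMat q c - spectralMat p b‖ / r := by
  have hgap : r ≤ |b k - c i| := by linarith [abs_sub_abs_le_abs_sub (b k) (c i)]
  rw [le_div_iff₀' hr]
  exact (mul_le_mul_of_nonneg_right hgap (abs_nonneg _)).trans
    (abs_sub_mul_abs_inner_eigenvector_le p q k i)

theorem abs_entry_spectralMat_le {s : ℝ} {i j : Fin n}
    (hi : ∀ k, b k ≠ 0 → |inner ℝ (p k) (q i)| ≤ s)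
    (hj : ∀ k, b k ≠ 0 → |inner ℝ (p k) (q j)| ≤ s) :
    |entry q i j (spectralMat p b)| ≤ (∑ k, |b k|) * s ^ 2 := by
  have hterm (k : Fin n) : |b k * (inner ℝ (p k) (q i) * inner ℝ (p k) (q j))| ≤ |b k| * s ^ 2 := by
    rcases eq_or_ne (b k) 0 with h | h
    · simp [h]
    · rw [abs_mul, abs_mul, sq]
      exact mul_le_mul_of_nonneg_left (mul_le_mul (hi k h) (hj k h) (abs_nonneg _)
        ((abs_nonneg _).trans (hi k h))) (abs_nonneg _)
  calc |entry q i j (spectralMat p b)|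
      = |∑ k, b k * (inner ℝ (p k) (q i) * inner ℝ (p k) (q j))| := by
        congr 1
        simp only [spectralMat_apply, map_sum, map_smul, entry_apply, act_outer,
          real_inner_smul_right, smul_eq_mul, real_inner_comm (p _) (q i)]
        exact Finset.sum_congr rfl fun k _ => by ring
    _ ≤ ∑ k, |b k| * s ^ 2 := Finset.abs_sum_le_sum_abs _ _ |>.trans
        (Finset.sum_le_sum fun k _ => hterm k)
    _ = (∑ k, |b k|) * s ^ 2 := (Finset.sum_mul _ _ _).symm

variable {P' : FrobMat n →L[ℝ] FrobMat n} {r : ℝ}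

theorem abs_entry_fderiv_projPSD_sub_le_of_abs_lt (hr : 0 < r) (hb : ∀ k, b k ≠ 0 → 2 * r ≤ |b k|)
    (hP : HasFDerivAt projPSD P' (spectralMat q c)) {i j : Fin n} (hi : |c i| < r)
    (hj : |c j| < r) :
    |entry q i j (P' (spectralMat p b) - projPSD (spectralMat p b))|
      ≤ 2 * (∑ k, |b k|) / r ^ 2 * ‖spectralMat q c - spectralMat p b‖ ^ 2 := by
  set s := ‖spectralMat q c - spectralMat p b‖ / r with hs
  have hsmall {l : Fin n} (hl : |c l| < r) (k : Fin n) (hk : b k ≠ 0) :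
      |inner ℝ (p k) (q l)| ≤ s := abs_inner_eigenvector_le p q hr (hb k hk) hl
  have hV : |entry q i j (P' (spectralMat p b))| ≤ (∑ k, |b k|) * s ^ 2 :=
    (abs_entry_fderiv_projPSD_le q hP (spectralMat_mem_symmetricMats p b)
      (eigenvalue_ne_zero_of_differentiableAt_projPSD q hP.differentiableAt i) j).trans
      (abs_entry_spectralMat_le p q (hsmall hi) (hsmall hj))
  have hP₀ : |entry q i j (projPSD (spectralMat p b))| ≤ (∑ k, |b k|) * s ^ 2 := by
    have hsupp (k : Fin n) (hk : b⁺ k ≠ 0) : b k ≠ 0 := fun h => hk (by simp [h])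
    rw [projPSD_spectralMat]
    refine (abs_entry_spectralMat_le p q (fun k hk => hsmall hi k (hsupp k hk))
      fun k hk => hsmall hj k (hsupp k hk)).trans
      (mul_le_mul_of_nonneg_right (Finset.sum_le_sum fun k _ => ?_) (sq_nonneg s))
    rw [abs_of_nonneg (posPart_nonneg b k)]
    exact sup_le (le_abs_self _) (abs_nonneg _)
  calc |entry q i j (P' (spectralMat p b) - projPSD (spectralMat p b))|
      ≤ (∑ k, |b k|) * s ^ 2 + (∑ k, |b k|) * s ^ 2 := by
        rw [map_sub]
        exact (abs_sub _ _).trans (add_le_add hV hP₀)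
    _ = 2 * (∑ k, |b k|) / r ^ 2 * ‖spectralMat q c - spectralMat p b‖ ^ 2 := by
        rw [hs]; ring

theorem abs_entry_fderiv_projPSD_sub_le_of_gap (hr : 0 < r) (hb : ∀ k, b k ≠ 0 → 2 * r ≤ |b k|)
    (hP : HasFDerivAt projPSD P' (spectralMat q c)) (i j : Fin n) :
    |entry q i j (P' (spectralMat p b) - projPSD (spectralMat p b))|
      ≤ (2 / r + 2 * (∑ k, |b k|) / r ^ 2) * ‖spectralMat q c - spectralMat p b‖ ^ 2 := by
  rw [add_mul]
  by_cases hsmall : |c i| < r ∧ |c j| < r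
  · have h := abs_entry_fderiv_projPSD_sub_le_of_abs_lt p q hr hb hP hsmall.1 hsmall.2
    exact h.trans (le_add_of_nonneg_left (by positivity))
  · have hlarge : r ≤ |c i| + |c j| := by
      rcases not_and_or.mp hsmall with h | h <;> linarith [abs_nonneg (c i), abs_nonneg (c j)]
    have h := (mul_le_mul_of_nonneg_right hlarge (abs_nonneg _)).trans
      (abs_entry_fderiv_projPSD_sub_le q hP (spectralMat_mem_symmetricMats p b) i j)
    refine ((le_div_iff₀' hr).mpr h).trans ?_
    rw [mul_div_right_comm]
    exact le_add_of_nonneg_right (by positivity)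

theorem exists_pos_forall_ne_zero_le_abs {ι : Type*} [Finite ι] (b : ι → ℝ) :
    ∃ r > 0, ∀ k, b k ≠ 0 → r ≤ |b k| := by
  have h : ∀ᶠ r in 𝓝[>] (0 : ℝ), ∀ k, b k ≠ 0 → r ≤ |b k| := by
    refine eventually_all.mpr fun k => eventually_imp_distrib_left.mpr fun hk => ?_
    exact nhdsWithin_le_nhds (Iic_mem_nhds (abs_pos.mpr hk))
  exact (eventually_mem_nhdsWithin.and h).exists

theorem isStronglySemismoothAt_projPSD {A₀ : FrobMat n} (hA₀ : A₀ ∈ symmetricMats n) :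
    IsStronglySemismoothAt projPSD A₀ := by
  obtain ⟨p, b, rfl⟩ := exists_eq_spectralMat hA₀
  obtain ⟨r, hr, hb⟩ := exists_pos_forall_ne_zero_le_abs b
  set C := 2 / (r / 2) + 2 * (∑ k, |b k|) / (r / 2) ^ 2
  refine IsStronglySemismoothAt.of_comp_projection (π := (symmetricMats n).starProjection)
    (C := n ^ 2 * C) (fun Z => Submodule.starProjection_eq_self_iff.mpr (by simp))
    projPSD_starProjection_symmetricMats (Submodule.starProjection_eq_self_iff.mpr hA₀)
    (Eventually.of_forall fun A hA hdiff => ?_)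
  have hP := hdiff.hasFDerivAt
  obtain ⟨q, c, rfl⟩ := exists_eq_spectralMat (Submodule.starProjection_eq_self_iff.mp hA)
  rw [map_sub, fderiv_projPSD_self hP, sub_sub_sub_cancel_left, mul_assoc]
  refine norm_le_of_abs_entry_le q fun i j => ?_
  exact abs_entry_fderiv_projPSD_sub_le_of_gap p q (half_pos hr)
    (fun k hk => by linarith [hb k hk]) hP i j

end Semismooth

/-! ### Norms on vector-matrix pairs -/

section PairNorms

variable {n : ℕ}

theorem norm_le_pairNorm (w : Pair n) : ‖w‖ ≤ pairNorm w :=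
  max_le (le_add_of_nonneg_right (norm_nonneg _)) (le_add_of_nonneg_left (norm_nonneg _))

theorem pairNorm_le_two_mul_norm (w : Pair n) : pairNorm w ≤ 2 * ‖w‖ := by
  rw [pairNorm, two_mul]
  exact add_le_add (norm_fst_le w) (norm_snd_le w)

theorem pairNorm_nonneg (w : Pair n) : 0 ≤ pairNorm w := add_nonneg (norm_nonneg _) (norm_nonneg _)

theorem pairInner_eq_inner_toLp (w w' : Pair n) :
    pairInner w w' = inner ℝ (WithLp.toLp 2 w) (WithLp.toLp 2 w') :=
  (WithLp.prod_inner_apply (WithLp.toLp 2 w) (WithLp.toLp 2 w')).symm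

theorem pairEuclNorm_eq_norm_toLp (w : Pair n) : pairEuclNorm w = ‖WithLp.toLp 2 w‖ := by
  rw [norm_eq_sqrt_real_inner, pairEuclNorm, pairInner_eq_inner_toLp]

theorem pairEuclNorm_sq (w : Pair n) : pairEuclNorm w ^ 2 = ‖w.1‖ ^ 2 + ‖w.2‖ ^ 2 := by
  rw [pairEuclNorm_eq_norm_toLp]
  exact WithLp.prod_norm_sq_eq_of_L2 _

theorem norm_le_pairEuclNorm (w : Pair n) : ‖w‖ ≤ pairEuclNorm w := by
  have hsq := pairEuclNorm_sq w
  have hnonneg : 0 ≤ pairEuclNorm w := Real.sqrt_nonneg _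
  refine max_le (le_of_sq_le_sq ?_ hnonneg) (le_of_sq_le_sq ?_ hnonneg)
  · linarith [sq_nonneg ‖w.2‖]
  · linarith [sq_nonneg ‖w.1‖]

theorem pairEuclNorm_le_pairNorm (w : Pair n) : pairEuclNorm w ≤ pairNorm w := by
  refine le_of_sq_le_sq ?_ (pairNorm_nonneg w)
  rw [pairEuclNorm_sq, pairNorm]
  nlinarith [norm_nonneg w.1, norm_nonneg w.2]

theorem abs_pairInner_le (w w' : Pair n) : |pairInner w w'| ≤ pairNorm w * pairNorm w' :=
  calc |pairInner w w'| ≤ pairEuclNorm w * pairEuclNorm w' := by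
        simpa only [pairInner_eq_inner_toLp, pairEuclNorm_eq_norm_toLp] using
          abs_real_inner_le_norm _ _
    _ ≤ pairNorm w * pairNorm w' :=
        mul_le_mul (pairEuclNorm_le_pairNorm w) (pairEuclNorm_le_pairNorm w') (Real.sqrt_nonneg _)
          (pairNorm_nonneg w)

theorem projDomain_mem_domain (w : Pair n) : projDomain w ∈ domain n := posSemidef_projPSD w.2

theorem pairInner_sub_projDomain_le_zero (w : Pair n) {s : Pair n} (hs : s ∈ domain n) :
    pairInner (w - projDomain w) (s - projDomain w) ≤ 0 := by
  simpa [pairInner, projDomain] using inner_sub_projPSD_le_zero w.2 hs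

end PairNorms

/-! ### The saddle operator and the residual map -/

namespace Data

variable {d n N : ℕ} {𝒳 𝒴 : Set (EuclideanSpace ℝ (Fin d))} {HX HY HXY : Type*}
  [NormedAddCommGroup HX] [InnerProductSpace ℝ HX]
  [NormedAddCommGroup HY] [InnerProductSpace ℝ HY]
  [NormedAddCommGroup HXY] [InnerProductSpace ℝ HXY]
  (D : Data d n N 𝒳 𝒴 HX HY HXY)

/-- `Φ` as a continuous linear map. -/
def PhiCLM : FrobMat n →L[ℝ] EuclideanSpace ℝ (Fin n) :=
  LinearMap.toContinuousLinearMap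
    { toFun := D.Phi
      map_add' X Y := by ext i; simp [Phi, inner_add_left]
      map_smul' c X := by ext i; simp [Phi, real_inner_smul_left] }

/-- `Φ⋆` as a continuous linear map. -/
def PhiStarCLM : EuclideanSpace ℝ (Fin n) →L[ℝ] FrobMat n :=
  LinearMap.toContinuousLinearMap
    { toFun := D.PhiStar
      map_add' a b := by simp [PhiStar, add_smul, Finset.sum_add_distrib]
      map_smul' c a := by simp [PhiStar, mul_smul, Finset.smul_sum] }

/-- The linear part `(1/(2λ₂)) Q γ - Φ(X)` of `gradGamma`. -/
def gradCLM : Pair n →L[ℝ] EuclideanSpace ℝ (Fin n) :=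
  ((1 / (2 * D.lam₂)) • Matrix.toEuclideanCLM (𝕜 := ℝ) D.Q).comp (.fst ℝ _ _)
    - D.PhiCLM.comp (.snd ℝ _ _)

/-- The linear part `X - Φ⋆(γ)` of the argument of the projection in `R`. -/
def argCLM : Pair n →L[ℝ] FrobMat n := .snd ℝ _ _ - D.PhiStarCLM.comp (.fst ℝ _ _)

theorem gradGamma_eq (w : Pair n) : D.gradGamma w = D.gradCLM w + -((1 / (2 * D.lam₂)) • D.z) := by
  rw [← sub_eq_add_neg]
  exact sub_right_comm _ _ _

theorem snd_sub_slack (w : Pair n) : w.2 - D.slack w.1 = D.argCLM w + -(D.lam₁ • ofMat 1) := by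
  rw [← sub_eq_add_neg]
  exact (sub_sub _ _ _).symm

theorem R_eq : D.R = fun w => (D.gradCLM w + -((1 / (2 * D.lam₂)) • D.z),
    w.2 - projPSD (D.argCLM w + -(D.lam₁ • ofMat 1))) := by
  funext w
  rw [R, gradGamma_eq, snd_sub_slack]

theorem inner_PhiStar (a : EuclideanSpace ℝ (Fin n)) (X : FrobMat n) :
    inner ℝ (D.PhiStar a) X = inner ℝ (D.Phi X) a := by
  rw [PhiStar, sum_inner, PiLp.inner_apply]
  refine Finset.sum_congr rfl fun i _ => ?_
  rw [real_inner_smul_left, real_inner_comm]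
  rfl

theorem posSemidef_Q : D.Q.PosSemidef := by
  have hsplit : D.Q = Matrix.gram ℝ (fun i => D.φX (D.xt i)) +
      Matrix.gram ℝ (fun i => D.φY (D.yt i)) := rfl
  rw [hsplit]
  exact (Matrix.posSemidef_gram ℝ _).add (Matrix.posSemidef_gram ℝ _)

theorem pairInner_saddleOp_sub_nonneg (w w' : Pair n) :
    0 ≤ pairInner (D.saddleOp w - D.saddleOp w') (w - w') := by
  have hfst : (D.saddleOp w - D.saddleOp w').1 =
      (1 / (2 * D.lam₂)) • Matrix.toEuclideanLin D.Q (w - w').1 - D.Phi (w - w').2 := by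
    change D.gradGamma w - D.gradGamma w' = D.gradCLM (w - w')
    rw [gradGamma_eq, gradGamma_eq, add_sub_add_right_eq_sub, map_sub]
  have hsnd : (D.saddleOp w - D.saddleOp w').2 = D.PhiStar (w - w').1 :=
    (add_sub_add_right_eq_sub _ _ _).trans (map_sub D.PhiStarCLM w.1 w'.1).symm
  have hQ := (Matrix.isPositive_toEuclideanLin_iff.mpr D.posSemidef_Q).re_inner_nonneg_left
    (w - w').1
  rw [pairInner, hfst, hsnd, inner_PhiStar, inner_sub_left, real_inner_smul_left, sub_add_cancel]
  exact mul_nonneg (one_div_nonneg.mpr (by linarith [D.lam₂_pos])) hQ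

variable {D} {x : Pair n}

theorem projPSD_snd_sub_slack_of_R_eq_zero (hx : D.R x = 0) :
    projPSD (x.2 - D.slack x.1) = x.2 :=
  (sub_eq_zero.mp (congrArg Prod.snd hx)).symm

theorem mem_domain_of_R_eq_zero (hx : D.R x = 0) : x ∈ domain n := by
  change (toMat x.2).PosSemidef
  rw [← projPSD_snd_sub_slack_of_R_eq_zero hx]
  exact posSemidef_projPSD _

theorem pairInner_saddleOp_nonneg_of_R_eq_zero (hx : D.R x = 0) {y : Pair n} (hy : y ∈ domain n) :
    0 ≤ pairInner (D.saddleOp x) (y - x) := by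
  have hgrad : D.gradGamma x = 0 := congrArg Prod.fst hx
  have hproj := inner_sub_projPSD_le_zero (x.2 - D.slack x.1) hy
  rw [projPSD_snd_sub_slack_of_R_eq_zero hx, sub_sub_cancel_left, inner_neg_left,
    neg_nonpos] at hproj
  simpa [pairInner, saddleOp, hgrad] using hproj

theorem pairEuclNorm_egStep_sub_le {η : ℝ} (hη : D.IsEGStepSize η) (hx : D.R x = 0) {v : Pair n}
    (hv : v ∈ domain n) : pairEuclNorm (D.egStep η v - x) ≤ pairEuclNorm (v - x) := by
  obtain ⟨hη, L, hL, hηL, hLip⟩ := hη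
  set y := projDomain (v - η • D.saddleOp v)
  have hyd : y ∈ domain n := projDomain_mem_domain _
  have hcorrector : pairInner (v - η • D.saddleOp y - D.egStep η v) (x - D.egStep η v) ≤ 0 :=
    pairInner_sub_projDomain_le_zero _ (mem_domain_of_R_eq_zero hx)
  have hpredictor : pairInner (v - η • D.saddleOp v - y) (D.egStep η v - y) ≤ 0 :=
    pairInner_sub_projDomain_le_zero _ (projDomain_mem_domain _)
  have hsolution : 0 ≤ pairInner (D.saddleOp y) (y - x) := by
    have hmono := D.pairInner_saddleOp_sub_nonneg y x
    have hroot := pairInner_saddleOp_nonneg_of_R_eq_zero hx hyd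
    rw [pairInner_eq_inner_toLp] at hmono hroot ⊢
    rw [WithLp.toLp_sub, inner_sub_left] at hmono
    linarith
  have hLipschitz := hLip y hyd v hv
  simp only [pairInner_eq_inner_toLp, pairEuclNorm_eq_norm_toLp, WithLp.toLp_sub,
    WithLp.toLp_smul] at hcorrector hpredictor hsolution hLipschitz ⊢
  exact norm_extragradient_sub_le hη.le ((lt_div_iff₀ hL).mp hηL).le hcorrector hpredictor
    hsolution hLipschitz

theorem exists_lipschitzWith_R (D : Data d n N 𝒳 𝒴 HX HY HXY) :
    ∃ K : NNReal, LipschitzWith K D.R := by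
  have hproj : LipschitzWith 1 (projPSD : FrobMat n → FrobMat n) :=
    LipschitzWith.of_dist_le_mul fun Z Y => by
      simpa [dist_eq_norm] using norm_projPSD_sub_le Z Y
  rw [R_eq]
  exact ⟨_, (D.gradCLM.lipschitz.add (.const _)).prodMk
    (LipschitzWith.prod_snd.sub (hproj.comp (D.argCLM.lipschitz.add (.const _))))⟩

theorem slack_mem_symmetricMats (D : Data d n N 𝒳 𝒴 HX HY HXY) (γ : EuclideanSpace ℝ (Fin n)) :
    D.slack γ ∈ symmetricMats n := by
  have hone : (ofMat 1 : FrobMat n) ∈ symmetricMats n :=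
    mem_symmetricMats_of_posSemidef Matrix.PosSemidef.one
  exact add_mem (sum_mem fun i _ => Submodule.smul_mem _ _
    (outer_self_mem_symmetricMats (WithLp.toLp 2 (D.U.col i)))) (Submodule.smul_mem _ _ hone)

theorem isStronglySemismoothAt_R (hx : D.R x = 0) : IsStronglySemismoothAt D.R x := by
  have hsymm : D.argCLM x + -(D.lam₁ • ofMat 1) ∈ symmetricMats n := by
    rw [← snd_sub_slack]
    exact sub_mem (mem_symmetricMats_of_posSemidef (mem_domain_of_R_eq_zero hx))
      (D.slack_mem_symmetricMats x.1)
  have hinr (Y : FrobMat n) : D.argCLM (ContinuousLinearMap.inr ℝ _ _ Y) = Y := by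
    simp [argCLM]
  rw [R_eq]
  exact (((isStronglySemismoothAt_projPSD hsymm).comp_affine hinr).affine_sub
    (.snd ℝ _ _)).affine_prodMk _ _

end Data

/-! ### Local convergence of the algorithm -/

namespace Params

variable (p : Params)

/-- An upper bound for the regularization parameters, as long as the middle case of the update,
which multiplies by a possibly large `β₁`, does not occur. -/
def θmax : ℝ := max p.θinit (max p.θlo p.θhi)

theorem θinit_mem_Icc : p.θinit ∈ Set.Icc 0 p.θmax := ⟨p.θinit_pos.le, le_max_left _ _⟩

theorem nextTheta_mem_Icc {θ ρ s : ℝ} (hθ : θ ∈ Set.Icc 0 p.θmax)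
    (hρ : p.α₁ * s ≤ ρ → p.α₂ * s ≤ ρ) : p.nextTheta θ ρ s ∈ Set.Icc 0 p.θmax := by
  have hlo : p.θlo ≤ p.θmax := (le_max_left _ _).trans (le_max_right _ _)
  have hhi : p.θhi ≤ p.θmax := (le_max_right _ _).trans (le_max_right _ _)
  rw [nextTheta]
  split_ifs with hlarge hmiddle
  · exact ⟨p.θlo_pos.le.trans (le_max_left _ _),
      max_le hlo ((mul_le_of_le_one_left hθ.1 p.β₀_lt.le).trans hθ.2)⟩
  · exact absurd (hρ hmiddle) hlarge
  · exact ⟨le_min p.θhi_pos.le (mul_nonneg (zero_le_one.trans p.β₂_gt.le) hθ.1),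
      (min_le_left _ _).trans hhi⟩

end Params

section Convergence

variable {d n N : ℕ} {𝒳 𝒴 : Set (EuclideanSpace ℝ (Fin d))} {HX HY HXY : Type*}
  [NormedAddCommGroup HX] [InnerProductSpace ℝ HX]
  [NormedAddCommGroup HY] [InnerProductSpace ℝ HY]
  [NormedAddCommGroup HXY] [InnerProductSpace ℝ HXY]
  {D : Data d n N 𝒳 𝒴 HX HY HXY} {p : Params} {x : Pair n}

/-- `Δ` is an admissible inexact regularized Newton direction at `w`, for the generalized Jacobian
`J` and the regularization parameter `θ`. -/
structure IsNewtonStep (D : Data d n N 𝒳 𝒴 HX HY HXY) (p : Params) (w : Pair n)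
    (J : Pair n →L[ℝ] Pair n) (θ : ℝ) (Δ : Pair n) : Prop where
  jac_mem : J ∈ clarkeJacobian D.R w
  theta_mem : θ ∈ Set.Icc 0 p.θmax
  residual_le : pairNorm (J Δ + (θ * pairNorm (D.R w)) • Δ + D.R w)
    ≤ p.τ * min 1 (p.κ * pairNorm (D.R w) * pairNorm Δ)

theorem pairNorm_R_le {K : NNReal} (hK : LipschitzWith K D.R) (hx : D.R x = 0) (w : Pair n) :
    pairNorm (D.R w) ≤ 2 * K * ‖w - x‖ :=
  calc pairNorm (D.R w) ≤ 2 * ‖D.R w‖ := pairNorm_le_two_mul_norm _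
    _ ≤ 2 * (K * ‖w - x‖) := by gcongr; simpa [hx] using hK.norm_sub_le w x
    _ = 2 * K * ‖w - x‖ := by ring

theorem IsNewtonStep.norm_apply_add_R_le {K : NNReal} (hK : LipschitzWith K D.R) (hx : D.R x = 0)
    {w Δ : Pair n} {J : Pair n →L[ℝ] Pair n} {θ : ℝ} (h : IsNewtonStep D p w J θ Δ) :
    ‖J Δ + D.R w‖ ≤ (4 * K + p.θmax * (2 * K)) * ‖w - x‖ * ‖Δ‖ := by
  have hR := pairNorm_R_le hK hx w
  have hR₀ := pairNorm_nonneg (D.R w)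
  have hresidual : ‖J Δ + (θ * pairNorm (D.R w)) • Δ + D.R w‖ ≤ 2 * K * ‖w - x‖ * (2 * ‖Δ‖) :=
    calc ‖J Δ + (θ * pairNorm (D.R w)) • Δ + D.R w‖
        ≤ p.τ * min 1 (p.κ * pairNorm (D.R w) * pairNorm Δ) :=
          (norm_le_pairNorm _).trans h.residual_le
      _ ≤ p.τ * (p.κ * pairNorm (D.R w) * pairNorm Δ) :=
          mul_le_mul_of_nonneg_left (min_le_right _ _) p.τ_pos.le
      _ = p.τ * p.κ * (pairNorm (D.R w) * pairNorm Δ) := by ring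
      _ ≤ pairNorm (D.R w) * pairNorm Δ :=
          mul_le_of_le_one_left (mul_nonneg hR₀ (pairNorm_nonneg _))
            (mul_le_one₀ p.τ_lt.le p.κ_pos.le p.κ_lt.le)
      _ ≤ _ := mul_le_mul hR (pairNorm_le_two_mul_norm Δ) (pairNorm_nonneg _) (by positivity)
  have hregularization : ‖(θ * pairNorm (D.R w)) • Δ‖ ≤ p.θmax * (2 * K * ‖w - x‖) * ‖Δ‖ := by
    rw [norm_smul, Real.norm_of_nonneg (mul_nonneg h.theta_mem.1 hR₀)]
    gcongr
    · exact h.theta_mem.1.trans h.theta_mem.2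
    · exact h.theta_mem.2
  calc ‖J Δ + D.R w‖
      = ‖(J Δ + (θ * pairNorm (D.R w)) • Δ + D.R w) - (θ * pairNorm (D.R w)) • Δ‖ := by
        congr 1; abel
    _ ≤ 2 * K * ‖w - x‖ * (2 * ‖Δ‖) + p.θmax * (2 * K * ‖w - x‖) * ‖Δ‖ :=
        (norm_sub_le _ _).trans (add_le_add hresidual hregularization)
    _ = _ := by ring

/-- The ball of radius `r` about `x` is a basin of quadratic convergence with constant `C` for the
Newton steps. The last field says that the middle case of the parameter update never occurs. -/
structure IsNewtonBasin (D : Data d n N 𝒳 𝒴 HX HY HXY) (p : Params) (x : Pair n) (r C : ℝ) :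
    Prop where
  mul_pairNorm_R_le {w : Pair n} (hw : ‖w - x‖ < r) : C * pairNorm (D.R w) ≤ 1 / 2
  norm_add_sub_le {w Δ : Pair n} {J : Pair n →L[ℝ] Pair n} {θ : ℝ} (hw : ‖w - x‖ < r)
    (h : IsNewtonStep D p w J θ Δ) : ‖w + Δ - x‖ ≤ ‖w - x‖
  pairNorm_R_add_le {w Δ : Pair n} {J : Pair n →L[ℝ] Pair n} {θ : ℝ} (hw : ‖w - x‖ < r)
    (h : IsNewtonStep D p w J θ Δ) : pairNorm (D.R (w + Δ)) ≤ C * pairNorm (D.R w) ^ 2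
  le_neg_pairInner {w Δ : Pair n} {J : Pair n →L[ℝ] Pair n} {θ : ℝ} (hw : ‖w - x‖ < r)
    (h : IsNewtonStep D p w J θ Δ) : p.α₁ * pairNorm Δ ^ 2 ≤ -pairInner (D.R (w + Δ)) Δ →
      p.α₂ * pairNorm Δ ^ 2 ≤ -pairInner (D.R (w + Δ)) Δ

theorem mul_sq_le_neg_pairInner {R Δ : Pair n} {α β : ℝ} (hα : 0 < α)
    (hR : ‖R‖ ≤ α / 4 * ‖Δ‖) (h : α * pairNorm Δ ^ 2 ≤ -pairInner R Δ) :
    β * pairNorm Δ ^ 2 ≤ -pairInner R Δ := by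
  have hupper : -pairInner R Δ ≤ α / 2 * pairNorm Δ ^ 2 :=
    calc -pairInner R Δ ≤ pairNorm R * pairNorm Δ := (neg_le_abs _).trans (abs_pairInner_le _ _)
      _ ≤ 2 * (α / 4 * pairNorm Δ) * pairNorm Δ := by
          refine mul_le_mul_of_nonneg_right ((pairNorm_le_two_mul_norm R).trans ?_)
            (pairNorm_nonneg Δ)
          gcongr
          exact hR.trans (by gcongr; exact norm_le_pairNorm Δ)
      _ = α / 2 * pairNorm Δ ^ 2 := by ring
  have hzero : pairNorm Δ ^ 2 = 0 := by nlinarith [sq_nonneg (pairNorm Δ)]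
  rw [hzero, mul_zero] at h ⊢
  exact h

theorem exists_isNewtonBasin (p : Params) (hx : D.R x = 0)
    (hinv : ∀ J ∈ clarkeJacobian D.R x, IsUnit J) :
    ∃ r > 0, ∃ C > 0, IsNewtonBasin D p x r C := by
  obtain ⟨K, hK⟩ := D.exists_lipschitzWith_R
  have hθmax : 0 ≤ p.θmax := p.θinit_mem_Icc.1.trans p.θinit_mem_Icc.2
  obtain ⟨C, hstep⟩ := exists_eventually_newton_step hK (Data.isStronglySemismoothAt_R hx) hx
    (fun J hJ => (ContinuousLinearMap.isUnit_iff_bijective.mp (hinv J hJ)).injective)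
    (a := 4 * K + p.θmax * (2 * K)) (by positivity) (c := p.α₁ / 4) (by linarith [p.α₁_pos])
  have hC : 0 < 2 * |C| + 1 := by positivity
  obtain ⟨r, hr, hball⟩ := Metric.eventually_nhds_iff.mp
    (hstep.and (eventually_mul_norm_sub_lt x ((2 * |C| + 1) * (2 * K)) one_half_pos))
  simp only [dist_eq_norm] at hball
  refine ⟨r, hr, 2 * |C| + 1, hC, fun hw => ?_, fun hw h => ?_, fun {w Δ _ _} hw h => ?_,
    fun hw h => ?_⟩
  · refine (mul_le_mul_of_nonneg_left (pairNorm_R_le hK hx _) hC.le).trans ?_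
    linarith [(hball hw).2]
  · exact ((hball hw).1 _ h.jac_mem _ (h.norm_apply_add_R_le hK hx)).1
  · have hquad := ((hball hw).1 _ h.jac_mem _ (h.norm_apply_add_R_le hK hx)).2.1
    calc pairNorm (D.R (w + Δ)) ≤ 2 * ‖D.R (w + Δ)‖ := pairNorm_le_two_mul_norm _
      _ ≤ 2 * (|C| * pairNorm (D.R w) ^ 2) := by
          gcongr
          refine hquad.trans ?_
          gcongr
          · exact le_abs_self C
          · exact norm_le_pairNorm _
      _ ≤ (2 * |C| + 1) * pairNorm (D.R w) ^ 2 := by linarith [sq_nonneg (pairNorm (D.R w))]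
  · exact mul_sq_le_neg_pairInner p.α₁_pos
      ((hball hw).1 _ h.jac_mem _ (h.norm_apply_add_R_le hK hx)).2.2

namespace IsRun

variable {η r C : ℝ} {w v Δ : ℕ → Pair n} {J : ℕ → Pair n →L[ℝ] Pair n} {θ : ℕ → ℝ}
  (h : IsRun D p η w v Δ J θ)

include h

theorem v_mem_domain (k : ℕ) : v k ∈ domain n := by
  cases k with
  | zero => exact h.init_v ▸ h.init_mem
  | succ k => exact h.step_v k ▸ projDomain_mem_domain _

theorem pairEuclNorm_v_sub_le (hη : D.IsEGStepSize η) (hx : D.R x = 0) (k : ℕ) :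
    pairEuclNorm (v k - x) ≤ pairEuclNorm (w 0 - x) := by
  induction k with
  | zero => rw [h.init_v]
  | succ k ih =>
    rw [h.step_v]
    exact (Data.pairEuclNorm_egStep_sub_le hη hx (h.v_mem_domain k)).trans ih

theorem next_eq_or_eq (k : ℕ) :
    w (k + 1) = w k + Δ k ∨
      w (k + 1) = v (k + 1) ∧ pairNorm (D.R (v (k + 1))) < pairNorm (D.R (w k + Δ k)) :=
  (le_or_gt _ _).imp (h.accept k) fun hlt => ⟨h.safeguard k hlt, hlt⟩

theorem isNewtonStep {k : ℕ} (hθ : θ k ∈ Set.Icc 0 p.θmax) :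
    IsNewtonStep D p (w k) (J k) (θ k) (Δ k) :=
  ⟨h.jac_mem k, hθ, h.newton k⟩

theorem norm_sub_lt_and_theta_mem (hη : D.IsEGStepSize η) (hx : D.R x = 0)
    (hbasin : IsNewtonBasin D p x r C) (hw₀ : pairNorm (w 0 - x) < r) (k : ℕ) :
    ‖w k - x‖ < r ∧ θ k ∈ Set.Icc 0 p.θmax := by
  induction k with
  | zero => exact ⟨(norm_le_pairNorm _).trans_lt hw₀, h.init_θ ▸ p.θinit_mem_Icc⟩
  | succ k ih =>
    obtain ⟨hw, hθ⟩ := ih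
    have hstep := h.isNewtonStep hθ
    refine ⟨?_, h.step_θ k ▸ p.nextTheta_mem_Icc hθ (hbasin.le_neg_pairInner hw hstep)⟩
    rcases h.next_eq_or_eq k with heq | ⟨heq, -⟩
    · exact heq ▸ (hbasin.norm_add_sub_le hw hstep).trans_lt hw
    · calc ‖w (k + 1) - x‖ ≤ pairEuclNorm (v (k + 1) - x) := heq ▸ norm_le_pairEuclNorm _
        _ ≤ pairEuclNorm (w 0 - x) := h.pairEuclNorm_v_sub_le hη hx (k + 1)
        _ ≤ pairNorm (w 0 - x) := pairEuclNorm_le_pairNorm _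
        _ < r := hw₀

theorem pairNorm_R_succ_le (hbasin : IsNewtonBasin D p x r C) {k : ℕ} (hw : ‖w k - x‖ < r)
    (hθ : θ k ∈ Set.Icc 0 p.θmax) :
    pairNorm (D.R (w (k + 1))) ≤ C * pairNorm (D.R (w k)) ^ 2 := by
  have hnewton := hbasin.pairNorm_R_add_le hw (h.isNewtonStep hθ)
  rcases h.next_eq_or_eq k with heq | ⟨heq, hlt⟩
  · rwa [heq]
  · exact heq ▸ hlt.le.trans hnewton

end IsRun

end Convergence

end KernelOT

end

theorem theorem2 {d n N : ℕ} {𝒳 𝒴 : Set (EuclideanSpace ℝ (Fin d))} {HX HY HXY : Type*}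
    [NormedAddCommGroup HX] [InnerProductSpace ℝ HX]
    [NormedAddCommGroup HY] [InnerProductSpace ℝ HY]
    [NormedAddCommGroup HXY] [InnerProductSpace ℝ HXY]
    (D : KernelOT.Data d n N 𝒳 𝒴 HX HY HXY) (p : KernelOT.Params)
    (η : ℝ) (hη : D.IsEGStepSize η)
    (wstar : KernelOT.Pair n) (hroot : D.R wstar = 0)
    (hinv : ∀ J ∈ KernelOT.clarkeJacobian D.R wstar, IsUnit J) :
    ∃ ε : ℝ, 0 < ε ∧ ∃ C : ℝ, 0 < C ∧
      ∀ w : ℕ → KernelOT.Pair n, KernelOT.GeneratedBy D p η w →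
        KernelOT.pairNorm (w 0 - wstar) < ε →
        (∀ k, KernelOT.pairNorm (D.R (w (k + 1))) ≤ C * KernelOT.pairNorm (D.R (w k)) ^ 2) ∧
        Tendsto (fun k => KernelOT.pairNorm (D.R (w k))) atTop (𝓝 0) := by
  obtain ⟨r, hr, C, hC, hbasin⟩ := KernelOT.exists_isNewtonBasin p hroot hinv
  refine ⟨r, hr, C, hC, fun w ⟨v, Δ, J, θ, hrun⟩ hw₀ => ?_⟩
  have hinvariant := hrun.norm_sub_lt_and_theta_mem hη hroot hbasin hw₀
  have hquadratic (k : ℕ) :=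
    hrun.pairNorm_R_succ_le hbasin (hinvariant k).1 (hinvariant k).2
  exact ⟨hquadratic, KernelOT.tendsto_zero_of_succ_le_mul_sq
    (fun k => KernelOT.pairNorm_nonneg _)
    (fun k => hbasin.mul_pairNorm_R_le (hinvariant k).1) hquadratic⟩
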